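/- Let $X$ be a countably infinite set. A chart of $X$ is a bijection between two subsets of $X$; let $I_X$ be the symmetric inverse monoid of all charts of $X$ under composition (wherever possible). For $A,B\subseteq I_X$ write $A\preccurlyeq B$ if there is a finite set $U\subseteq I_X$ such that $A$ is contained in the subsemigroup $\langle B\cup U\rangle$ of $I_X$, and $A\approx B$ if $A\preccurlyeq B$ and $B\preccurlyeq A$ (Bergman–Shelah equivalence in $I_X$). Let $\mathcal P_\omega$ be any $\aleph_0$-unbounded partition of $X$, i.e. a partition of $X$ into finite parts whose sizes have no common finite bound, and let $\mathrm{PStab}(\mathcal P_\omega)=\{f\in\mathrm{Sym}(X) : \Sigma f=\Sigma \text{ for all } \Sigma\in\mathcal P_\omega\}$. Let $T$ be a rooted tree with vertex set $X$, and let $P$ be the set of all (finite or infinite) paths $(x_i)_{i<\ell}$, $1\le \ell\le\omega$, in $T$ that start at the root. Let $S(T)$ be the set (an inverse subsemigroup of $I_X$) of path-bijections of $T$, i.e. of all charts $f$ for which there are $p=(x_i)_{i<\ell}$ and $q$ in $P$ such that $\operatorname{dom} f=\{x_i : i<\ell\}$ and $(x_if)_{i<\ell}=q$. A subtree of $T$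 is a subgraph of $T$ that is a tree and contains the root of $T$, which is then also its root. A vertex $y\ne x$ of a rooted tree is a descendant of $x$ if $x$ lies on the path from $y$ to the root; the degree of a vertex is its number of neighbours. Then exactly one of the following holds. (i) $T$ contains a subtree $T'$ such that every vertex of $T'$ has, in $T'$, a descendant of infinite degree, and $S(T)\approx I_X$. (ii) $T$ contains no subtree as in (i), but $T$ contains a subtree $T'$ such that every vertex of $T'$ has, in $T'$, a descendant of degree at least $3$, and $S(T)\approx \mathrm{PStab}(\mathcal P_\omega)$. (iii) $P$ is countable, and $S(T)\approx\emptyset$. (In (i) and (ii), descendants and degrees are taken in $T'$.) -/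

import Mathlib

universe u

/-! ### The symmetric inverse monoid -/

/-- The symmetric inverse monoid `I_X`: partial bijections (charts) of `X`, i.e. bijections between
subsets of `X`. -/
abbrev SymInvMonoid (X : Type u) : Type u := X ≃. X

/-- Charts are composed from left to right, wherever possible. -/
instance SymInvMonoid.instMonoid (X : Type u) : Monoid (SymInvMonoid X) where
  mul f g := PEquiv.trans f g
  one := PEquiv.refl X
  mul_assoc f g h := PEquiv.trans_assoc f g h
  one_mul f := PEquiv.refl_trans f
  mul_one f := PEquiv.trans_refl f

/-- The domain of a chart. -/
def SymInvMonoid.dom {X : Type u} (f : SymInvMonoid X) : Set X := {x | ∃ y, f x = some y}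

/-! ### The Bergman–Shelah preorder -/

/-- `A ≼ B` in the semigroup `M`: there is a finite set `U ⊆ M` such that `A` is contained in the
subsemigroup of `M` generated by `B ∪ U`. -/
def BSLe {M : Type u} [Mul M] (A B : Set M) : Prop :=
  ∃ U : Set M, U.Finite ∧ A ⊆ (Subsemigroup.closure (B ∪ U) : Set M)

/-- Bergman–Shelah equivalence. -/
def BSEquiv {M : Type u} [Mul M] (A B : Set M) : Prop := BSLe A B ∧ BSLe B A

/-! ### Partitions and their partwise stabilisers -/

/-- A `κ`-unbounded partition of `X`: all parts have cardinality smaller than `κ`, but these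
cardinalities have no common bound below `κ`. -/
def IsUnboundedPartition {X : Type u} (κ : Cardinal.{u}) (P : Set (Set X)) : Prop :=
  Setoid.IsPartition P ∧ (∀ A ∈ P, Cardinal.mk A < κ) ∧
    ∀ c < κ, ∃ A ∈ P, c < Cardinal.mk A

/-- The partwise stabiliser of `P`: the permutations of `X` that map each part of `P` onto itself,
seen as charts. -/
def PStab {X : Type u} (P : Set (Set X)) : Set (SymInvMonoid X) :=
  {f | ∃ σ : Equiv.Perm X, (∀ A ∈ P, σ '' A = A) ∧ f = σ.toPEquiv}

/-! ### Rooted trees -/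

/-- A rooted tree on the vertex set `X`. -/
structure RootedTreeOn (X : Type u) where
  graph : SimpleGraph X
  isTree : graph.IsTree
  root : X

namespace RootedTreeOn

variable {X : Type u}

/-- `y` is a descendant of `x`: they are distinct, and `x` lies on the path from `y` to the root. -/
def IsDescendant (T : RootedTreeOn X) (y x : X) : Prop :=
  y ≠ x ∧ ∃ p : T.graph.Walk y T.root, p.IsPath ∧ x ∈ p.support

/-- The degree (number of neighbours) of a vertex, equal to `⊤` when it is infinite. -/
noncomputable def degree (T : RootedTreeOn X) (x : X) : ℕ∞ := (T.graph.neighborSet x).encard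

/-- A subtree of `T`: a subgraph that is a tree and contains the root of `T`. -/
structure Subtree (T : RootedTreeOn X) where
  subgraph : T.graph.Subgraph
  isTree : subgraph.coe.IsTree
  root_mem : T.root ∈ subgraph.verts

/-- A subtree as a rooted tree in its own right, with the same root. -/
def Subtree.toRootedTree {T : RootedTreeOn X} (S : T.Subtree) : RootedTreeOn S.subgraph.verts where
  graph := S.subgraph.coe
  isTree := S.isTree
  root := ⟨T.root, S.root_mem⟩

/-- `T` contains a subtree `S` in which (descendants and degrees being taken in `S`) every vertex
has a descendant of degree at least `d`; for `d = ⊤` this means a descendant of infinite degree. -/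
def HasBranchingSubtree (T : RootedTreeOn X) (d : ℕ∞) : Prop :=
  ∃ S : T.Subtree, ∀ x : S.subgraph.verts, ∃ y : S.subgraph.verts,
    S.toRootedTree.IsDescendant y x ∧ d ≤ S.toRootedTree.degree y

/-- The (finite or infinite) paths in `T` starting at the root. A path `(x_i)_{i < l}` with
`1 ≤ l ≤ ω` is encoded as the sequence with value `some x_i` for `i < l` and `none` for `i ≥ l`. -/
def rootedPaths (T : RootedTreeOn X) : Set (ℕ → Option X) :=
  {p | p 0 = some T.root ∧
    (∀ n y, p (n + 1) = some y → ∃ x, p n = some x ∧ T.graph.Adj x y) ∧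
    ∀ m n x, p m = some x → p n = some x → m = n}

/-- The set of path-bijections of `T`: the charts `f` for which there are rooted paths
`p = (x_i)` and `q` such that the domain of `f` is the vertex set of `p`, and `(x_i f) = q`. -/
def pathBijections (T : RootedTreeOn X) : Set (SymInvMonoid X) :=
  {f | ∃ p ∈ T.rootedPaths, ∃ q ∈ T.rootedPaths,
    SymInvMonoid.dom f = {x | ∃ i, p i = some x} ∧ (fun i => (p i).bind f) = q}

end RootedTreeOn

/-- Exactly one of three propositions holds. -/
def ExactlyOneOfThree (a b c : Prop) : Prop :=
  (a ∧ ¬ b ∧ ¬ c) ∨ (¬ a ∧ b ∧ ¬ c) ∨ (¬ a ∧ ¬ b ∧ c)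

/-! ### Charts -/

namespace SymInvMonoid

variable {X : Type u}

/-! Countable sets of charts are negligible for `BSLe` (`bsLe_of_countable`), and a path-bijection
either has finite domain or is the chart between two rays, i.e. infinite paths from the root. So
only the rays matter, and the class of S(T) depends on how richly they branch.

Upper bounds. Fix a σ-ideal of small sets of rays and keep the vertices whose rays do not form a
small set. Unless all rays together are small, these vertices span a subtree, which must branch
(`small_rays_of_not_hasBranchingSubtree`). For degree 3, small means countable, so without a
branching subtree S(T) is negligible. For infinite degree, small means covered by countably many
vertex sets with finite levels. Each level of such a set embeds in a finite part of the partition, a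
ray becomes a transversal of parts, and the partwise stabiliser carries a fixed transversal to any
other.

Lower bounds. In a tree branching with degree 3, a ray can encode any chart f that preserves the
fibres of a given finite-to-one map: there are finitely many possibilities on each fibre, and a
suitable vertex of the ray remembers both a point x and the action of f on the fibre of x. One
universal chart then executes every f, once the ray of f is supplied by S(T) (`bsLe_fibrewise_nat`).
This covers the partwise stabiliser. With infinite branching, a ray can moreover be cut into blocks
that grow as fast as desired, with one finite-to-one map constant on the blocks of all these rays.
Any chart reduces to two factors, each preserving the blocks of one of two interleaved sequences,
hence to the previous case (`bsLe_univ_pathBijections`).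

The cases exclude each other because a subtree branching with degree 3 already has uncountably many
rays. -/

theorem mul_eq_some (f g : SymInvMonoid X) (x z : X) :
    (f * g) x = some z ↔ ∃ y, f x = some y ∧ g y = some z :=
  PEquiv.trans_eq_some f g x z

theorem ext_iff_some {f g : SymInvMonoid X} (h : ∀ x y, f x = some y ↔ g x = some y) : f = g :=
  PEquiv.ext fun x => Option.ext fun y => h x y

theorem inj_of_eq_some (f : SymInvMonoid X) {x x' y : X} (h : f x = some y) (h' : f x' = some y) :
    x = x' :=
  PEquiv.inj f h h'

open Classical in
/-- The chart whose graph is a given relation, provided that the relation is the graph of a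
chart. -/
noncomputable def ofRel (r : X → X → Prop) (h₁ : ∀ x y z, r x y → r x z → y = z)
    (h₂ : ∀ x y z, r x z → r y z → x = y) : SymInvMonoid X where
  toFun x := if h : ∃ y, r x y then some h.choose else none
  invFun y := if h : ∃ x, r x y then some h.choose else none
  inv x y := by
    constructor
    · intro h
      split_ifs at h with hx
      have hr : r x y := by
        have := hx.choose_spec
        rw [Option.some.inj h] at this
        exact this
      have hy : ∃ y, r x y := ⟨y, hr⟩
      rw [dif_pos hy, h₁ _ _ _ hy.choose_spec hr]
    · intro h
      split_ifs at h with hy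
      have hr : r x y := by
        have := hy.choose_spec
        rw [Option.some.inj h] at this
        exact this
      have hx : ∃ x, r x y := ⟨x, hr⟩
      rw [dif_pos hx, h₂ _ _ _ hx.choose_spec hr]

open Classical in
theorem ofRel_eq_some {r : X → X → Prop} {h₁ : ∀ x y z, r x y → r x z → y = z}
    {h₂ : ∀ x y z, r x z → r y z → x = y} {x y : X} : ofRel r h₁ h₂ x = some y ↔ r x y := by
  change (if h : ∃ y, r x y then some h.choose else none) = some y ↔ _
  constructor
  · intro h
    split_ifs at h with hx
    have := hx.choose_spec
    rwa [Option.some.inj h] at this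
  · intro h
    have hx : ∃ y, r x y := ⟨y, h⟩
    rw [dif_pos hx, h₁ _ _ _ hx.choose_spec h]

/-- The chart `a i ↦ b i` for injective families `a` and `b`. -/
noncomputable def ofSeq {ι : Type*} (a b : ι → X) (ha : a.Injective) (hb : b.Injective) :
    SymInvMonoid X :=
  ofRel (fun x y => ∃ i, a i = x ∧ b i = y)
    (by rintro x y z ⟨i, hi, rfl⟩ ⟨j, hj, rfl⟩; rw [ha (hi.trans hj.symm)])
    (by rintro x y z ⟨i, rfl, hi⟩ ⟨j, rfl, hj⟩; rw [hb (hi.trans hj.symm)])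

theorem ofSeq_eq_some {ι : Type*} {a b : ι → X} {ha : a.Injective} {hb : b.Injective} {x y : X} :
    ofSeq a b ha hb x = some y ↔ ∃ i, a i = x ∧ b i = y :=
  ofRel_eq_some

theorem ofSeq_mul {ι : Type*} {a b c : ι → X} (ha : a.Injective) (hb : b.Injective)
    (hc : c.Injective) : ofSeq a b ha hb * ofSeq b c hb hc = ofSeq a c ha hc := by
  refine ext_iff_some fun x z => ?_
  simp only [mul_eq_some, ofSeq_eq_some]
  constructor
  · rintro ⟨y, ⟨i, rfl, rfl⟩, j, hj, rfl⟩
    exact ⟨i, rfl, by rw [hb hj]⟩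
  · rintro ⟨i, rfl, rfl⟩
    exact ⟨b i, ⟨i, rfl, rfl⟩, i, rfl, rfl⟩

theorem countable_finite_dom [Countable X] :
    {f : SymInvMonoid X | (dom f).Finite}.Countable := by
  classical
  have : Function.Injective (fun f : {f : SymInvMonoid X | (dom f).Finite} =>
      (f.2.toFinset.image fun x => (x, f.1 x) : Finset (X × Option X))) := by
    rintro ⟨f, hf⟩ ⟨g, hg⟩ h
    refine Subtype.ext (ext_iff_some fun x y => ?_)
    have key : ∀ f : SymInvMonoid X, ∀ hf : (dom f).Finite,
        f x = some y ↔ (x, some y) ∈ hf.toFinset.image fun x => (x, f x) := by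
      intro f hf
      simp only [Finset.mem_image, Set.Finite.mem_toFinset, Prod.mk.injEq]
      constructor
      · intro h
        exact ⟨x, ⟨y, h⟩, rfl, h⟩
      · rintro ⟨_, _, rfl, h⟩
        exact h
    rw [key f hf, key g hg]
    exact iff_of_eq (congrArg (fun s : Finset (X × Option X) => (x, some y) ∈ s) h)
  exact Set.countable_coe_iff.mp this.countable

end SymInvMonoid

/-! ### The Bergman–Shelah preorder -/

section BSLe

variable {M : Type u} [Mul M] {A B C : Set M}

theorem BSLe.of_subset (h : A ⊆ B) : BSLe A B :=
  ⟨∅, Set.finite_empty, fun _ ha => Subsemigroup.subset_closure (Or.inl (h ha))⟩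

theorem BSLe.of_subset_closure (h : A ⊆ Subsemigroup.closure B) : BSLe A B :=
  ⟨∅, Set.finite_empty, by simpa using h⟩

theorem BSLe.trans (hAB : BSLe A B) (hBC : BSLe B C) : BSLe A C := by
  obtain ⟨U, hU, hA⟩ := hAB
  obtain ⟨V, hV, hB⟩ := hBC
  refine ⟨U ∪ V, hU.union hV, hA.trans ?_⟩
  rw [SetLike.coe_subset_coe, Subsemigroup.closure_le]
  refine Set.union_subset (hB.trans ?_) ?_
  · exact Subsemigroup.closure_mono (Set.union_subset_union_right _ Set.subset_union_right)
  · exact fun x hx => Subsemigroup.subset_closure (Or.inr (Or.inl hx))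

theorem BSLe.union (hA : BSLe A C) (hB : BSLe B C) : BSLe (A ∪ B) C := by
  obtain ⟨U, hU, hA⟩ := hA
  obtain ⟨V, hV, hB⟩ := hB
  refine ⟨U ∪ V, hU.union hV, Set.union_subset (hA.trans ?_) (hB.trans ?_)⟩
  · exact Subsemigroup.closure_mono (Set.union_subset_union_right _ Set.subset_union_left)
  · exact Subsemigroup.closure_mono (Set.union_subset_union_right _ Set.subset_union_right)

end BSLe

namespace SymInvMonoid

variable {X : Type u}

/-- Every countable set of charts is contained in a finitely generated subsemigroup. -/
theorem bsLe_of_countable [Countable X] [Infinite X] {A : Set (SymInvMonoid X)}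
    (hA : A.Countable) (B : Set (SymInvMonoid X)) : BSLe A B := by
  rcases A.eq_empty_or_nonempty with rfl | hne
  · exact BSLe.of_subset (Set.empty_subset _)
  obtain ⟨F, rfl⟩ := hA.exists_eq_range hne
  obtain ⟨e⟩ : Nonempty (X × ℕ ≃ X) := by
    obtain ⟨d⟩ := nonempty_denumerable X
    exact ⟨(Equiv.prodCongr (Denumerable.eqv X) (Equiv.refl ℕ)).trans
      ((Denumerable.eqv (ℕ × ℕ)).trans (Denumerable.eqv X).symm)⟩
  have inj : ∀ n, Function.Injective fun x => e (x, n) := fun n x y h => by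
    simpa using e.injective h
  have sinj : Function.Injective fun x : X × ℕ => e (x.1, x.2 + 1) := fun x y h => by
    have := e.injective h
    simp only [Prod.mk.injEq, add_left_inj] at this
    exact Prod.ext this.1 this.2
  let a : ℕ → SymInvMonoid X := fun n => ofSeq id (fun x => e (x, n)) Function.injective_id (inj n)
  let b : ℕ → SymInvMonoid X := fun n => ofSeq (fun x => e (x, n)) id (inj n) Function.injective_id
  let s : SymInvMonoid X := ofSeq e (fun x => e (x.1, x.2 + 1)) e.injective sinj
  let t : SymInvMonoid X := ofSeq (fun x => e (x.1, x.2 + 1)) e sinj e.injective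
  -- X is split into countably many copies of itself, and `f` acts on copy n as `F n`. The shifts
  -- `s` and `t` generate all passages `a n` into and `b n` out of copy n.
  let f : SymInvMonoid X := ofRel
    (fun x y => ∃ u v n, e (u, n) = x ∧ e (v, n) = y ∧ F n u = some v)
    (by
      rintro x y z ⟨u, v, n, rfl, rfl, h⟩ ⟨u', v', n', h', rfl, h''⟩
      have := e.injective h'
      simp only [Prod.mk.injEq] at this
      obtain ⟨rfl, rfl⟩ := this
      rw [h] at h''
      rw [Option.some.inj h''])
    (by
      rintro x y z ⟨u, v, n, rfl, rfl, h⟩ ⟨u', v', n', rfl, h', h''⟩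
      have := e.injective h'
      simp only [Prod.mk.injEq] at this
      obtain ⟨rfl, rfl⟩ := this
      rw [(F n').inj_of_eq_some h h''])
  refine ⟨{a 0, b 0, s, t, f}, by simp, ?_⟩
  set G := Subsemigroup.closure (B ∪ {a 0, b 0, s, t, f}) with hG
  have mem : ∀ g ∈ ({a 0, b 0, s, t, f} : Set (SymInvMonoid X)), g ∈ G :=
    fun g hg => Subsemigroup.subset_closure (Or.inr hg)
  have ha : ∀ n, a n ∈ G := by
    intro n
    induction n with
    | zero => exact mem _ (by simp)
    | succ n ih =>
      have : a (n + 1) = a n * s := by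
        refine ext_iff_some fun x z => ?_
        simp only [mul_eq_some, a, s, ofSeq_eq_some]
        constructor
        · rintro ⟨x, rfl, rfl⟩
          exact ⟨e (x, n), ⟨x, rfl, rfl⟩, (x, n), rfl, rfl⟩
        · rintro ⟨_, ⟨x, rfl, rfl⟩, i, hi, rfl⟩
          rw [e.injective hi]
          exact ⟨x, rfl, rfl⟩
      rw [this]
      exact mul_mem ih (mem _ (by simp))
  have hb : ∀ n, b n ∈ G := by
    intro n
    induction n with
    | zero => exact mem _ (by simp)
    | succ n ih =>
      have : b (n + 1) = t * b n := by
        refine ext_iff_some fun x z => ?_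
        simp only [mul_eq_some, b, t, ofSeq_eq_some]
        constructor
        · rintro ⟨x, rfl, rfl⟩
          exact ⟨e (x, n), ⟨(x, n), rfl, rfl⟩, x, rfl, rfl⟩
        · rintro ⟨_, ⟨i, rfl, rfl⟩, x, hx, rfl⟩
          rw [← e.injective hx]
          exact ⟨x, rfl, rfl⟩
      rw [this]
      exact mul_mem (mem _ (by simp)) ih
  rintro _ ⟨n, rfl⟩
  have : F n = a n * f * b n := by
    refine ext_iff_some fun x z => ?_
    simp only [mul_eq_some, a, b, f, ofSeq_eq_some, ofRel_eq_some]
    constructor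
    · intro h
      exact ⟨e (z, n), ⟨e (x, n), ⟨x, rfl, rfl⟩, x, z, n, rfl, rfl, h⟩, z, rfl, rfl⟩
    · rintro ⟨_, ⟨_, ⟨x, rfl, rfl⟩, u, v, m, h₁, rfl, h⟩, w, hw, rfl⟩
      have h₁ := e.injective h₁
      have hw := e.injective hw
      simp only [Prod.mk.injEq] at h₁ hw
      obtain ⟨rfl, rfl⟩ := h₁
      obtain ⟨rfl, -⟩ := hw
      exact h
  rw [SetLike.mem_coe, this]
  exact mul_mem (mul_mem (ha n) (mem _ (by simp))) (hb n)

theorem bsLe_of_subset_closure_union [Countable X] [Infinite X] {A B B' C : Set (SymInvMonoid X)}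
    (h : A ⊆ Subsemigroup.closure (B ∪ B' ∪ C)) (hB' : BSLe B' B) (hC : C.Countable) :
    BSLe A B :=
  (BSLe.of_subset_closure h).trans
    (((BSLe.of_subset subset_rfl).union hB').union (bsLe_of_countable hC B))

end SymInvMonoid

/-! ### Parents and levels in rooted trees -/

namespace RootedTreeOn

variable {X : Type u} (T : RootedTreeOn X)

/-- The distance of a vertex from the root. -/
noncomputable def level (x : X) : ℕ := T.graph.dist T.root x

theorem level_eq_zero {x : X} : T.level x = 0 ↔ x = T.root := by
  rw [level, T.isTree.connected.dist_eq_zero_iff, eq_comm]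

@[simp] theorem level_root : T.level T.root = 0 := T.level_eq_zero.2 rfl

theorem level_of_adj {x y : X} (h : T.graph.Adj x y) :
    T.level x = T.level y + 1 ∨ T.level y = T.level x + 1 := by
  have := T.isTree.dist_eq_dist_add_one_of_adj T.root h
  simpa [level] using this

theorem exists_adj_level {x : X} (hx : x ≠ T.root) :
    ∃ y, T.graph.Adj x y ∧ T.level x = T.level y + 1 := by
  obtain ⟨p, hp⟩ := T.isTree.connected.exists_walk_length_eq_dist x T.root
  cases p with
  | nil => exact absurd rfl hx
  | @cons _ y _ h p =>
    refine ⟨y, h, (T.level_of_adj h).resolve_right fun hy => ?_⟩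
    have h₁ := SimpleGraph.dist_le p
    rw [SimpleGraph.Walk.length_cons, SimpleGraph.dist_comm] at hp
    rw [SimpleGraph.dist_comm] at h₁
    simp only [level] at hy
    omega

/-- Each such neighbour begins a geodesic to the root, and paths in a tree are unique. -/
theorem adj_level_unique {x y z : X} (hy : T.graph.Adj x y) (hz : T.graph.Adj x z)
    (hy' : T.level x = T.level y + 1) (hz' : T.level x = T.level z + 1) : y = z := by
  have key : ∀ w, ∀ h : T.graph.Adj x w, T.level x = T.level w + 1 →
      ∃ p : T.graph.Walk w T.root, (SimpleGraph.Walk.cons h p).IsPath := by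
    intro w h hw
    obtain ⟨p, hp⟩ := T.isTree.connected.exists_walk_length_eq_dist w T.root
    refine ⟨p, SimpleGraph.Walk.isPath_of_length_eq_dist _ ?_⟩
    rw [SimpleGraph.Walk.length_cons, hp, SimpleGraph.dist_comm, T.graph.dist_comm (u := x)]
    exact hw.symm
  obtain ⟨p, hp⟩ := key y hy hy'
  obtain ⟨q, hq⟩ := key z hz hz'
  have := (T.isTree.existsUnique_path x T.root).unique hp hq
  injection this

open Classical in
/-- The neighbour of a vertex towards the root; the root is its own parent. -/
noncomputable def parent (x : X) : X :=
  if h : x = T.root then T.root else (T.exists_adj_level h).choose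

@[simp] theorem parent_root : T.parent T.root = T.root := by simp [parent]

theorem adj_parent {x : X} (hx : x ≠ T.root) : T.graph.Adj x (T.parent x) := by
  rw [parent, dif_neg hx]
  exact (T.exists_adj_level hx).choose_spec.1

theorem level_eq_level_parent_add_one {x : X} (hx : x ≠ T.root) :
    T.level x = T.level (T.parent x) + 1 := by
  rw [parent, dif_neg hx]
  exact (T.exists_adj_level hx).choose_spec.2

theorem level_parent (x : X) : T.level (T.parent x) = T.level x - 1 := by
  by_cases hx : x = T.root
  · simp [hx]
  · rw [T.level_eq_level_parent_add_one hx, Nat.add_sub_cancel]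

theorem adj_iff {x y : X} :
    T.graph.Adj x y ↔ (x ≠ T.root ∧ T.parent x = y) ∨ (y ≠ T.root ∧ T.parent y = x) := by
  have key : ∀ {x y : X}, T.graph.Adj x y → T.level x = T.level y + 1 →
      x ≠ T.root ∧ T.parent x = y := by
    intro x y h hl
    have hx : x ≠ T.root := by
      rintro rfl
      simp at hl
    exact ⟨hx, T.adj_level_unique (T.adj_parent hx) h (T.level_eq_level_parent_add_one hx) hl⟩
  constructor
  · intro h
    exact (T.level_of_adj h).imp (key h) (key h.symm)
  · rintro (⟨hx, rfl⟩ | ⟨hy, rfl⟩)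
    · exact T.adj_parent hx
    · exact (T.adj_parent hy).symm

@[simp] theorem parent_iterate_root (k : ℕ) : T.parent^[k] T.root = T.root :=
  Function.iterate_fixed T.parent_root k

theorem level_parent_iterate (x : X) (k : ℕ) : T.level (T.parent^[k] x) = T.level x - k := by
  induction k with
  | zero => rfl
  | succ k ih => rw [Function.iterate_succ_apply', level_parent, ih]; omega

theorem parent_iterate_level (x : X) : T.parent^[T.level x] x = T.root :=
  T.level_eq_zero.1 (by rw [level_parent_iterate, Nat.sub_self])

/-- `x` lies on the path from `y` to the root. -/
def IsAncestor (x y : X) : Prop := ∃ k, T.parent^[k] y = x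

theorem exists_path_support (y : X) :
    ∃ p : T.graph.Walk y T.root, p.IsPath ∧ ∀ x, x ∈ p.support ↔ T.IsAncestor x y := by
  induction h : T.level y generalizing y with
  | zero =>
    obtain rfl := T.level_eq_zero.1 h
    refine ⟨.nil, by simp, fun x => ?_⟩
    simp [IsAncestor, eq_comm]
  | succ n ih =>
    have hy : y ≠ T.root := by
      rintro rfl
      simp at h
    obtain ⟨p, hp, hs⟩ := ih (T.parent y) (by rw [level_parent, h]; rfl)
    refine ⟨.cons (T.adj_parent hy) p, ?_, fun x => ?_⟩
    · rw [SimpleGraph.Walk.cons_isPath_iff]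
      refine ⟨hp, fun hmem => ?_⟩
      obtain ⟨k, hk⟩ := (hs y).1 hmem
      have := congrArg T.level hk
      rw [level_parent_iterate, level_parent] at this
      omega
    · rw [SimpleGraph.Walk.support_cons, List.mem_cons, hs]
      constructor
      · rintro (rfl | ⟨k, hk⟩)
        · exact ⟨0, rfl⟩
        · exact ⟨k + 1, hk⟩
      · rintro ⟨_ | k, hk⟩
        · exact Or.inl hk.symm
        · exact Or.inr ⟨k, hk⟩

theorem isDescendant_iff {x y : X} : T.IsDescendant y x ↔ y ≠ x ∧ T.IsAncestor x y := by
  obtain ⟨p, hp, hs⟩ := T.exists_path_support y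
  rw [IsDescendant, ← hs]
  refine and_congr_right fun _ => ⟨?_, fun h => ⟨p, hp, h⟩⟩
  rintro ⟨q, hq, hx⟩
  rwa [(T.isTree.existsUnique_path y T.root).unique hp hq]

variable {T}

theorem IsAncestor.refl (x : X) : T.IsAncestor x x := ⟨0, rfl⟩

theorem IsAncestor.trans {x y z : X} (h : T.IsAncestor x y) (h' : T.IsAncestor y z) :
    T.IsAncestor x z := by
  obtain ⟨k, rfl⟩ := h
  obtain ⟨l, rfl⟩ := h'
  exact ⟨k + l, Function.iterate_add_apply _ _ _ _⟩

theorem IsAncestor.level_le {x y : X} (h : T.IsAncestor x y) : T.level x ≤ T.level y := by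
  obtain ⟨k, rfl⟩ := h
  rw [level_parent_iterate]
  omega

variable (T) in
/-- The ancestor of `x` at level `j`, for `j ≤ T.level x`. -/
noncomputable def anc (x : X) (j : ℕ) : X := T.parent^[T.level x - j] x

theorem isAncestor_anc (x : X) (j : ℕ) : T.IsAncestor (T.anc x j) x := ⟨_, rfl⟩

theorem level_anc {x : X} {j : ℕ} (h : j ≤ T.level x) : T.level (T.anc x j) = j := by
  rw [anc, level_parent_iterate]
  omega

theorem IsAncestor.anc_eq {x y : X} (h : T.IsAncestor x y) : T.anc y (T.level x) = x := by
  obtain ⟨k, rfl⟩ := h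
  rw [anc, level_parent_iterate]
  rcases le_total k (T.level y) with hk | hk
  · congr 2; omega
  · have : ∀ k, T.level y ≤ k → T.parent^[k] y = T.root := fun k hk =>
      T.level_eq_zero.1 (by rw [level_parent_iterate]; omega)
    rw [this k hk, this _ (by omega)]

theorem IsAncestor.anc {x y : X} (h : T.IsAncestor x y) {j : ℕ} (hj : j ≤ T.level x) :
    T.anc y j = T.anc x j := by
  have := ((isAncestor_anc x j).trans h).anc_eq
  rwa [level_anc hj] at this

theorem IsAncestor.eq_of_level {x y z : X} (h : T.IsAncestor x z) (h' : T.IsAncestor y z)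
    (hl : T.level x = T.level y) : x = y := by
  rw [← h.anc_eq, hl, h'.anc_eq]

theorem IsAncestor.of_level_le {x y z : X} (h : T.IsAncestor x z) (h' : T.IsAncestor y z)
    (hl : T.level x ≤ T.level y) : T.IsAncestor x y := by
  rw [← h.anc_eq, h'.anc hl]
  exact isAncestor_anc _ _

theorem IsAncestor.eq_or_parent {x y : X} (h : T.IsAncestor x y) :
    x = y ∨ T.IsAncestor x (T.parent y) := by
  obtain ⟨_ | k, hk⟩ := h
  · exact Or.inl hk.symm
  · exact Or.inr ⟨k, hk⟩

theorem anc_succ_ne_root {x : X} {j : ℕ} (h : j + 1 ≤ T.level x) : T.anc x (j + 1) ≠ T.root := by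
  intro h'
  have := level_anc h
  rw [h', level_root] at this
  omega

theorem parent_anc_succ {x : X} {j : ℕ} (h : j + 1 ≤ T.level x) :
    T.parent (T.anc x (j + 1)) = T.anc x j := by
  have := Function.iterate_succ_apply' T.parent (T.level x - (j + 1)) x
  rw [anc, anc, ← this]
  congr 2; omega

theorem finite_ancestors (y : X) : {x | T.IsAncestor x y}.Finite := by
  refine ((Set.finite_Iic (T.level y)).image (T.anc y)).subset fun x hx => ?_
  exact ⟨T.level x, hx.level_le, hx.anc_eq⟩

variable (T)

/-- The set of children of a vertex. -/
def children (x : X) : Set X := {y | y ≠ T.root ∧ T.parent y = x}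

variable {T}

theorem level_of_mem_children {x y : X} (h : y ∈ T.children x) : T.level y = T.level x + 1 := by
  rw [T.level_eq_level_parent_add_one h.1, h.2]

theorem isAncestor_of_mem_children {x y : X} (h : y ∈ T.children x) : T.IsAncestor x y :=
  ⟨1, h.2⟩

theorem neighborSet_subset (x : X) : T.graph.neighborSet x ⊆ insert (T.parent x) (T.children x) := by
  intro y hy
  rcases T.adj_iff.1 hy with h | h
  · exact Or.inl h.2.symm
  · exact Or.inr h

theorem exists_pair_of_three_le_degree {x : X} (h : 3 ≤ T.degree x) :
    ∃ y ∈ T.children x, ∃ z ∈ T.children x, y ≠ z := by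
  have h₁ : 3 ≤ (insert (T.parent x) (T.children x)).encard :=
    h.trans (Set.encard_le_encard (neighborSet_subset x))
  have h₂ : 3 ≤ (T.children x).encard + 1 := h₁.trans (Set.encard_insert_le _ _)
  have h₃ : 1 < (T.children x).encard := by
    by_contra hlt
    have : (T.children x).encard + 1 ≤ 1 + 1 := by gcongr; exact not_lt.1 hlt
    exact absurd (h₂.trans this) (by decide)
  obtain ⟨y, z, hy, hz, hyz⟩ := Set.one_lt_encard_iff.1 h₃
  exact ⟨y, hy, z, hz, hyz⟩

theorem infinite_children_of_degree_eq_top {x : X} (h : ⊤ ≤ T.degree x) :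
    (T.children x).Infinite := by
  have : (T.graph.neighborSet x).Infinite := Set.encard_eq_top_iff.1 (top_le_iff.1 h)
  intro hfin
  exact this ((hfin.insert _).subset (neighborSet_subset x))

/-! ### Rays -/

variable (T) in
/-- An infinite path that starts at the root. -/
def IsRay (p : ℕ → X) : Prop := p 0 = T.root ∧ ∀ n, p (n + 1) ∈ T.children (p n)

theorem IsRay.level {p : ℕ → X} (hp : T.IsRay p) (n : ℕ) : T.level (p n) = n := by
  induction n with
  | zero => rw [hp.1, level_root]
  | succ n ih => rw [level_of_mem_children (hp.2 n), ih]

theorem IsRay.injective {p : ℕ → X} (hp : T.IsRay p) : p.Injective := fun m n h => by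
  rw [← hp.level m, h, hp.level]

theorem IsRay.eq_of_eq {p q : ℕ → X} (hp : T.IsRay p) (hq : T.IsRay q) {m n : ℕ} (h : p m = q n) :
    m = n := by
  rw [← hp.level m, h, hq.level]

theorem IsRay.isAncestor {p : ℕ → X} (hp : T.IsRay p) {m n : ℕ} (h : m ≤ n) :
    T.IsAncestor (p m) (p n) := by
  induction n, h using Nat.le_induction with
  | base => exact .refl _
  | succ n _ ih => exact ih.trans (isAncestor_of_mem_children (hp.2 n))

theorem IsRay.anc_eq {p : ℕ → X} (hp : T.IsRay p) {m n : ℕ} (h : m ≤ n) :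
    T.anc (p n) m = p m := by
  have := (hp.isAncestor h).anc_eq
  rwa [hp.level] at this

theorem IsRay.some_mem_rootedPaths {p : ℕ → X} (hp : T.IsRay p) :
    (fun n => some (p n)) ∈ T.rootedPaths := by
  refine ⟨congrArg some hp.1, ?_, ?_⟩
  · intro n y h
    obtain rfl := Option.some.inj h
    exact ⟨_, rfl, T.adj_iff.2 (Or.inr (hp.2 n))⟩
  · intro m n x hm hn
    exact hp.injective ((Option.some.inj hm).trans (Option.some.inj hn).symm)

/-- A path that has just descended from a parent to a child cannot step up again without repeating
that parent. -/
theorem isRay_of_some_mem_rootedPaths {p : ℕ → X} (hp : (fun n => some (p n)) ∈ T.rootedPaths) :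
    T.IsRay p := by
  obtain ⟨h₀, h₁, h₂⟩ := hp
  have h₀ : p 0 = T.root := Option.some.inj h₀
  have hadj : ∀ n, T.graph.Adj (p n) (p (n + 1)) := by
    intro n
    obtain ⟨x, hx, h⟩ := h₁ n _ rfl
    rwa [← Option.some.inj hx] at h
  refine ⟨h₀, fun n => ?_⟩
  induction n with
  | zero =>
    rcases T.adj_iff.1 (hadj 0) with h | h
    · exact absurd h₀ h.1
    · exact h
  | succ n ih =>
    rcases T.adj_iff.1 (hadj (n + 1)) with h | h
    · have : n = n + 1 + 1 := h₂ _ _ (p n) rfl (congrArg some (h.2.symm.trans ih.2))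
      omega
    · exact h

/-- The ray through a sequence of vertices, each an ancestor of the next, that reach all levels. -/
theorem isRay_anc {v : ℕ → X} (hv : ∀ n, T.IsAncestor (v n) (v (n + 1)))
    (hl : ∀ n, n ≤ T.level (v n)) :
    T.IsRay (fun n => T.anc (v n) n) := by
  refine ⟨T.level_eq_zero.1 (level_anc (Nat.zero_le _)), fun n => ⟨anc_succ_ne_root (hl _), ?_⟩⟩
  change T.parent (T.anc (v (n + 1)) (n + 1)) = T.anc (v n) n
  rw [parent_anc_succ (hl _), (hv n).anc (hl n)]

/-- The chart between two rays is a path-bijection. -/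
theorem IsRay.ofSeq_mem {p q : ℕ → X} (hp : T.IsRay p) (hq : T.IsRay q) :
    SymInvMonoid.ofSeq p q hp.injective hq.injective ∈ T.pathBijections := by
  refine ⟨_, hp.some_mem_rootedPaths, _, hq.some_mem_rootedPaths, ?_, ?_⟩
  · ext x
    simp only [SymInvMonoid.dom, Set.mem_ofPred_eq, SymInvMonoid.ofSeq_eq_some, Option.some.injEq]
    exact ⟨fun ⟨_, i, hi, _⟩ => ⟨i, hi⟩, fun ⟨i, hi⟩ => ⟨_, i, hi, rfl⟩⟩
  · funext i
    exact SymInvMonoid.ofSeq_eq_some.2 ⟨i, rfl, rfl⟩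

theorem none_of_rootedPaths {p : ℕ → Option X} (hp : p ∈ T.rootedPaths) {m n : ℕ} (h : m ≤ n)
    (hm : p m = none) : p n = none := by
  induction n, h using Nat.le_induction with
  | base => exact hm
  | succ n _ ih =>
    cases hn : p (n + 1) with
    | none => rfl
    | some y =>
      obtain ⟨x, hx, _⟩ := hp.2.1 n y hn
      rw [ih] at hx
      exact absurd hx (by simp)

theorem eq_some_or_finite_of_mem_rootedPaths {p : ℕ → Option X} (hp : p ∈ T.rootedPaths) :
    (∃ q, T.IsRay q ∧ p = fun n => some (q n)) ∨ ∃ m, ∀ n ≥ m, p n = none := by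
  by_cases h : ∃ m, p m = none
  · obtain ⟨m, hm⟩ := h
    exact Or.inr ⟨m, fun n hn => none_of_rootedPaths hp hn hm⟩
  · push Not at h
    choose q hq using fun n => Option.ne_none_iff_exists'.1 (h n)
    obtain rfl : p = fun n => some (q n) := funext hq
    exact Or.inl ⟨q, isRay_of_some_mem_rootedPaths hp, rfl⟩

theorem finite_dom_or_ofSeq_of_mem_pathBijections {f : SymInvMonoid X}
    (hf : f ∈ T.pathBijections) : (SymInvMonoid.dom f).Finite ∨
      ∃ (p q : ℕ → X) (hp : T.IsRay p) (hq : T.IsRay q),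
        f = SymInvMonoid.ofSeq p q hp.injective hq.injective := by
  obtain ⟨p, hp, q, hq, hdom, hfq⟩ := hf
  rcases eq_some_or_finite_of_mem_rootedPaths hp with ⟨p, hp', rfl⟩ | ⟨m, hm⟩
  · right
    have hdom' : ∀ x, (∃ y, f x = some y) ↔ ∃ i, p i = x := fun x => by
      have := Set.ext_iff.1 hdom x
      simpa [SymInvMonoid.dom] using this
    choose r hr using fun i => (hdom' (p i)).2 ⟨i, rfl⟩
    obtain rfl : (fun n => some (r n)) = q := by
      rw [← hfq]
      funext i
      exact (hr i).symm
    refine ⟨p, r, hp', isRay_of_some_mem_rootedPaths hq, ?_⟩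
    refine SymInvMonoid.ext_iff_some fun x y => ?_
    rw [SymInvMonoid.ofSeq_eq_some]
    constructor
    · intro h
      obtain ⟨i, rfl⟩ := (hdom' x).1 ⟨y, h⟩
      exact ⟨i, rfl, Option.some.inj ((hr i).symm.trans h)⟩
    · rintro ⟨i, rfl, rfl⟩
      exact hr i
  · left
    rw [hdom]
    have : {x | ∃ i, p i = some x} ⊆ some ⁻¹' (p '' Set.Iio m) := by
      rintro x ⟨i, hi⟩
      refine ⟨i, Set.mem_Iio.2 (lt_of_not_ge fun h => ?_), hi⟩
      rw [hm i h] at hi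
      exact absurd hi (by simp)
    exact (((Set.finite_Iio m).image p).preimage (Option.some_injective X).injOn).subset this

/-- A finite path is a finite sequence in a countable set, so only the rays can make the set of
paths uncountable. -/
theorem countable_rootedPaths_iff [Countable X] :
    T.rootedPaths.Countable ↔ {p | T.IsRay p}.Countable := by
  constructor
  · intro h
    have hinj : Function.Injective fun (p : ℕ → X) n => some (p n) := fun p q hpq =>
      funext fun n => Option.some.inj (congrFun hpq n)
    exact (h.preimage hinj).mono fun p hp => hp.some_mem_rootedPaths
  · intro h
    have hfin : {p : ℕ → Option X | ∃ m, ∀ n ≥ m, p n = none}.Countable := by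
      rw [Set.ofPred_exists]
      refine Set.countable_iUnion fun m => ?_
      have : Function.Injective
          fun (p : {p : ℕ → Option X | ∀ n ≥ m, p n = none}) (i : Fin m) => p.1 i := by
        rintro ⟨p, hp⟩ ⟨q, hq⟩ hpq
        refine Subtype.ext (funext fun n => ?_)
        rcases lt_or_ge n m with hn | hn
        · exact congrFun hpq ⟨n, hn⟩
        · exact (hp n hn).trans (hq n hn).symm
      exact Set.countable_coe_iff.mp this.countable
    refine ((h.image fun p n => some (p n)).union hfin).mono fun p hp => ?_
    rcases eq_some_or_finite_of_mem_rootedPaths hp with ⟨q, hq, rfl⟩ | h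
    · exact Or.inl ⟨q, hq, rfl⟩
    · exact Or.inr h

theorem bsLe_pathBijections_empty [Countable X] [Infinite X] (h : T.rootedPaths.Countable) :
    BSLe T.pathBijections ∅ := by
  refine SymInvMonoid.bsLe_of_countable ?_ _
  have hr := countable_rootedPaths_iff.1 h
  have : Countable {p | T.IsRay p} := hr.to_subtype
  refine (SymInvMonoid.countable_finite_dom.union (Set.countable_range
    fun pq : {p | T.IsRay p} × {p | T.IsRay p} =>
      SymInvMonoid.ofSeq pq.1.1 pq.2.1 pq.1.2.injective pq.2.2.injective)).mono fun f hf => ?_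
  rcases finite_dom_or_ofSeq_of_mem_pathBijections hf with h | ⟨p, q, hp, hq, rfl⟩
  · exact Or.inl h
  · exact Or.inr ⟨(⟨p, hp⟩, ⟨q, hq⟩), rfl⟩

end RootedTreeOn

/-! ### Subtrees -/

namespace RootedTreeOn

variable {X : Type u} {T : RootedTreeOn X}

theorem isRay_of_adj_injective {p : ℕ → X} (h₀ : p 0 = T.root)
    (hadj : ∀ n, T.graph.Adj (p n) (p (n + 1))) (hinj : p.Injective) : T.IsRay p := by
  refine isRay_of_some_mem_rootedPaths ⟨congrArg some h₀, fun n y h => ?_, fun m n x hm hn => ?_⟩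
  · obtain rfl := Option.some.inj h
    exact ⟨_, rfl, hadj n⟩
  · exact hinj ((Option.some.inj hm).trans (Option.some.inj hn).symm)

theorem IsRay.of_subtree {S : T.Subtree} {p : ℕ → S.subgraph.verts}
    (hp : S.toRootedTree.IsRay p) : T.IsRay fun n => (p n : X) := by
  refine isRay_of_adj_injective (congrArg Subtype.val hp.1) (fun n => ?_)
    (Subtype.val_injective.comp hp.injective)
  have : S.toRootedTree.graph.Adj (p n) (p (n + 1)) := adj_iff _ |>.2 (Or.inr (hp.2 n))
  exact S.subgraph.adj_sub this

section AncestorClosed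

variable {K : Set X} (hroot : T.root ∈ K) (hK : ∀ x ∈ K, T.parent x ∈ K)

theorem reachable_root_induce (hroot : T.root ∈ K) (hK : ∀ x ∈ K, T.parent x ∈ K) (x : X) (hx : x ∈ K) :
    (((⊤ : T.graph.Subgraph).induce K).coe).Reachable ⟨x, hx⟩ ⟨T.root, hroot⟩ := by
  induction h : T.level x generalizing x with
  | zero =>
    obtain rfl := T.level_eq_zero.1 h
    exact .refl _
  | succ n ih =>
    have hx' : x ≠ T.root := by
      rintro rfl
      simp at h
    refine SimpleGraph.Reachable.trans (SimpleGraph.Adj.reachable ?_)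
      (ih (T.parent x) (hK x hx) (by rw [level_parent, h]; rfl))
    exact ⟨hx, hK x hx, T.adj_parent hx'⟩

/-- The subtree spanned by a set of vertices that contains the root and is closed under taking
parents. -/
def inducedSubtree (T : RootedTreeOn X) (K : Set X) (hroot : T.root ∈ K)
    (hK : ∀ x ∈ K, T.parent x ∈ K) : T.Subtree where
  subgraph := (⊤ : T.graph.Subgraph).induce K
  isTree := by
    refine ⟨?_, T.isTree.isAcyclic.subgraph _⟩
    have : Nonempty ((⊤ : T.graph.Subgraph).induce K).verts := ⟨⟨T.root, hroot⟩⟩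
    refine ⟨fun x y => ?_⟩
    exact (reachable_root_induce hroot hK x.1 x.2).trans
      (reachable_root_induce hroot hK y.1 y.2).symm
  root_mem := hroot

theorem inducedSubtree_adj {x y : (T.inducedSubtree K hroot hK).subgraph.verts} :
    (T.inducedSubtree K hroot hK).toRootedTree.graph.Adj x y ↔ T.graph.Adj x y :=
  ⟨fun h => h.2.2, fun h => ⟨x.2, y.2, h⟩⟩

/-- Distances can only grow in a subgraph; conversely the path to the root through parents stays in
`K`. -/
theorem level_inducedSubtree (x : (T.inducedSubtree K hroot hK).subgraph.verts) :
    (T.inducedSubtree K hroot hK).toRootedTree.level x = T.level x := by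
  set R := (T.inducedSubtree K hroot hK).toRootedTree
  have hle : ∀ x : (T.inducedSubtree K hroot hK).subgraph.verts, T.level x ≤ R.level x := by
    intro x
    obtain ⟨w, hw⟩ := R.isTree.connected.exists_walk_length_eq_dist R.root x
    have := SimpleGraph.dist_le (w.map (T.inducedSubtree K hroot hK).subgraph.hom)
    exact this.trans ((SimpleGraph.Walk.length_map _ w).trans hw).le
  obtain ⟨x, hx⟩ := x
  induction h : T.level x generalizing x with
  | zero =>
    obtain rfl := T.level_eq_zero.1 h
    exact R.level_root
  | succ n ih =>
    have hx' : x ≠ T.root := by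
      rintro rfl
      simp at h
    have h₁ := ih (T.parent x) (hK x hx) (by rw [level_parent, h]; rfl)
    have h₂ := hle ⟨x, hx⟩
    have h₃ := R.level_of_adj (x := ⟨x, hx⟩) (y := ⟨T.parent x, hK x hx⟩)
      ((inducedSubtree_adj hroot hK).2 (T.adj_parent hx'))
    simp only [h] at h₂
    omega

theorem parent_inducedSubtree (x : (T.inducedSubtree K hroot hK).subgraph.verts) :
    ((T.inducedSubtree K hroot hK).toRootedTree.parent x : X) = T.parent x := by
  set R := (T.inducedSubtree K hroot hK).toRootedTree
  by_cases hx : x = R.root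
  · have hx' : (x : X) = T.root := congrArg Subtype.val hx
    rw [hx', hx, parent_root, parent_root]
    rfl
  · have hx' : (x : X) ≠ T.root := fun h => hx (Subtype.ext h)
    refine T.adj_level_unique ((inducedSubtree_adj hroot hK).1 (R.adj_parent hx))
      (T.adj_parent hx') ?_ (T.level_eq_level_parent_add_one hx')
    rw [← level_inducedSubtree hroot hK, ← level_inducedSubtree hroot hK]
    exact R.level_eq_level_parent_add_one hx

theorem parent_iterate_inducedSubtree (x : (T.inducedSubtree K hroot hK).subgraph.verts) (k : ℕ) :
    ((T.inducedSubtree K hroot hK).toRootedTree.parent^[k] x : X) = T.parent^[k] x := by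
  induction k with
  | zero => rfl
  | succ k ih =>
    rw [Function.iterate_succ_apply', Function.iterate_succ_apply', parent_inducedSubtree, ih]

theorem degree_inducedSubtree (x : (T.inducedSubtree K hroot hK).subgraph.verts) :
    (T.inducedSubtree K hroot hK).toRootedTree.degree x = {y ∈ K | T.graph.Adj x y}.encard := by
  rw [degree, ← Subtype.val_injective.encard_image]
  congr 1
  ext y
  constructor
  · rintro ⟨y, hy, rfl⟩
    exact ⟨y.2, (inducedSubtree_adj hroot hK).1 hy⟩
  · rintro ⟨hy, h⟩
    exact ⟨(⟨y, hy⟩ : (T.inducedSubtree K hroot hK).subgraph.verts),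
      (inducedSubtree_adj hroot hK).2 h, rfl⟩

end AncestorClosed

/-! ### Rays in trees without branching subtrees -/

/-- If `T` has no branching subtree, then its rays form a small set, for every σ-ideal of small
sets of rays that is large enough. -/
theorem small_rays_of_not_hasBranchingSubtree (d : ℕ∞) (Small : Set (ℕ → X) → Prop)
    (empty : Small ∅) (mono : ∀ s t, s ⊆ t → Small t → Small s)
    (iUnion : ∀ s : X → Set (ℕ → X), (∀ x, Small (s x)) → Small (⋃ x, s x))
    (small : ∀ K : Set X, (∀ x ∈ K, T.parent x ∈ K) → ∀ y ∈ K, y ≠ T.root →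
      (∀ z ∈ K, T.IsAncestor y z → {w ∈ K | T.graph.Adj z w}.encard < d) →
      Small {p | T.IsRay p ∧ y ∈ Set.range p ∧ ∀ n, p n ∈ K})
    (h : ¬ T.HasBranchingSubtree d) : Small {p | T.IsRay p} := by
  by_contra hns
  -- The subtree on `K` has a vertex x without descendants of degree at least d. Rays through x
  -- either leave `K`, hence meet one of countably many vertices with few rays, or stay in `K` and
  -- pass through a child y of x. Passing to y matters: x is not its own descendant, so its degree
  -- is not controlled.
  let K : Set X := {x | ¬ Small {p | T.IsRay p ∧ x ∈ Set.range p}}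
  have hroot : T.root ∈ K := by
    intro hs
    refine hns (mono _ _ ?_ hs)
    exact fun p hp => ⟨hp, 0, hp.1⟩
  have hK : ∀ x ∈ K, T.parent x ∈ K := by
    intro x hx hs
    refine hx (mono _ _ ?_ hs)
    rintro p ⟨hp, n, rfl⟩
    refine ⟨hp, ?_⟩
    cases n with
    | zero => exact ⟨0, by rw [hp.1, parent_root]⟩
    | succ n => exact ⟨n, (hp.2 n).2.symm⟩
  refine h ⟨T.inducedSubtree K hroot hK, fun x => ?_⟩
  by_contra hx
  push Not at hx
  refine x.2 (mono _ (⋃ y : X, {p | T.IsRay p ∧ y ∈ Set.range p ∧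
    (y ∉ K ∨ (y ∈ K ∧ y ∈ T.children x ∧ ∀ n, p n ∈ K))}) ?_ (iUnion _ fun y => ?_))
  · rintro p ⟨hp, n, hn⟩
    rw [Set.mem_iUnion]
    by_cases hpK : ∀ m, p m ∈ K
    · refine ⟨p (n + 1), hp, ⟨_, rfl⟩, Or.inr ⟨hpK _, ?_, hpK⟩⟩
      rw [← hn]
      exact hp.2 n
    · push Not at hpK
      obtain ⟨m, hm⟩ := hpK
      exact ⟨p m, hp, ⟨m, rfl⟩, Or.inl hm⟩
  · by_cases hyK : y ∈ K
    · by_cases hyx : y ∈ T.children x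
      · refine mono _ _ ?_ (small K hK y hyK hyx.1 fun z hz hyz => ?_)
        · rintro p ⟨hp, hy, h | h⟩
          · exact absurd hyK h
          · exact ⟨hp, hy, h.2.2⟩
        · rw [← degree_inducedSubtree hroot hK ⟨z, hz⟩]
          refine hx ⟨z, hz⟩ ((isDescendant_iff _).2 ⟨?_, ?_⟩)
          · rintro rfl
            have := hyz.level_le
            rw [level_of_mem_children hyx] at this
            simp at this
          · obtain ⟨k, hk⟩ := (isAncestor_of_mem_children hyx).trans hyz
            exact ⟨k, Subtype.ext ((parent_iterate_inducedSubtree hroot hK _ k).trans hk)⟩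
      · refine mono _ ∅ ?_ empty
        rintro p ⟨hp, hy, h | h⟩
        · exact absurd hyK h
        · exact absurd h.2.1 hyx
    · refine mono _ {p | T.IsRay p ∧ y ∈ Set.range p} (fun p hp => ⟨hp.1, hp.2.1⟩) ?_
      exact not_not.1 hyK

/-- Below y each vertex of `K` has at most its parent and one child as neighbours in `K`, so at most
one ray through y stays in `K`. -/
theorem countable_rays_of_not_hasBranchingSubtree_three [Countable X]
    (h : ¬ T.HasBranchingSubtree 3) : {p | T.IsRay p}.Countable := by
  refine small_rays_of_not_hasBranchingSubtree 3 Set.Countable Set.countable_empty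
    (fun s t hst ht => ht.mono hst)
    (fun s hs => Set.countable_iUnion hs) (fun K hK y hy hne hdeg => ?_) h
  refine Set.Subsingleton.countable ?_
  rintro p ⟨hp, ⟨k, rfl⟩, hpK⟩ q ⟨hq, ⟨l, hl⟩, hqK⟩
  obtain rfl := hp.eq_of_eq hq hl.symm
  have hle : ∀ n, k ≤ n → p n = q n := by
    intro n hn
    induction n, hn using Nat.le_induction with
    | base => exact hl.symm
    | succ n hn ih =>
      by_contra hpq
      have hlt := hdeg (p n) (hpK n) (hp.isAncestor hn)
      have hroot : p n ≠ T.root := by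
        intro h
        rw [← hp.1] at h
        have := hp.injective h
        obtain rfl : k = 0 := by omega
        exact hne hp.1
      have hpar : ∀ w, w ∈ T.children (p n) → T.parent (p n) ≠ w := by
        rintro w hw rfl
        have h₁ := level_of_mem_children hw
        rw [level_parent] at h₁
        omega
      have hp' := hp.2 n
      have hq' : q (n + 1) ∈ T.children (p n) := ih ▸ hq.2 n
      have hsub : {T.parent (p n), p (n + 1), q (n + 1)} ⊆ {w ∈ K | T.graph.Adj (p n) w} := by
        rintro w (rfl | rfl | rfl)
        · exact ⟨hK _ (hpK n), T.adj_parent hroot⟩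
        · exact ⟨hpK _, T.adj_iff.2 (Or.inr hp')⟩
        · exact ⟨hqK _, T.adj_iff.2 (Or.inr hq')⟩
      have := Set.encard_le_encard hsub
      rw [Set.encard_eq_three.2 ⟨_, _, _, hpar _ hp', hpar _ hq', hpq, rfl⟩] at this
      exact absurd hlt (not_lt.2 this)
  funext n
  rcases le_total k n with hn | hn
  · exact hle n hn
  · rw [← hp.anc_eq hn, ← hq.anc_eq hn, hl]

/-- The rays of `T` are covered by countably many locally finite sets of vertices, if `T` has no
subtree with infinite branching. -/
theorem exists_cover_of_not_hasBranchingSubtree_top [Countable X]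
    (h : ¬ T.HasBranchingSubtree ⊤) :
    ∃ 𝓗 : Set (Set X), 𝓗.Countable ∧ (∀ H ∈ 𝓗, ∀ n, {v ∈ H | T.level v = n}.Finite) ∧
      ∀ p, T.IsRay p → ∃ H ∈ 𝓗, ∀ n, p n ∈ H := by
  let Small : Set (ℕ → X) → Prop := fun s =>
    ∃ 𝓗 : Set (Set X), 𝓗.Countable ∧ (∀ H ∈ 𝓗, ∀ n, {v ∈ H | T.level v = n}.Finite) ∧
      ∀ p ∈ s, ∃ H ∈ 𝓗, ∀ n, p n ∈ H
  refine small_rays_of_not_hasBranchingSubtree ⊤ Small ?_ ?_ ?_ ?_ h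
  · exact ⟨∅, Set.countable_empty, by simp, by simp⟩
  · rintro s t hst ⟨𝓗, h₁, h₂, h₃⟩
    exact ⟨𝓗, h₁, h₂, fun p hp => h₃ p (hst hp)⟩
  · intro s hs
    choose 𝓗 h₁ h₂ h₃ using hs
    refine ⟨⋃ x, 𝓗 x, Set.countable_iUnion h₁, fun H hH => ?_, fun p hp => ?_⟩
    · obtain ⟨x, hx⟩ := Set.mem_iUnion.1 hH
      exact h₂ x H hx
    · obtain ⟨x, hx⟩ := Set.mem_iUnion.1 hp
      obtain ⟨H, hH, h⟩ := h₃ x p hx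
      exact ⟨H, Set.mem_iUnion.2 ⟨x, hH⟩, h⟩
  · intro K hK y hy hne hdeg
    -- A single set suffices: below y the vertices of `K` have finite degree in `K`, so by induction
    -- each level is finite.
    refine ⟨{{v | T.IsAncestor v y} ∪ {v ∈ K | T.IsAncestor y v}}, Set.countable_singleton _,
      ?_, ?_⟩
    · rintro _ rfl n
      have key : ∀ n, {v ∈ K | T.IsAncestor y v ∧ T.level v = n}.Finite := by
        intro n
        induction n with
        | zero =>
          refine (Set.finite_singleton T.root).subset fun v hv => ?_
          exact T.level_eq_zero.1 hv.2.2
        | succ n ih =>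
          have hfin : (⋃ z ∈ {v ∈ K | T.IsAncestor y v ∧ T.level v = n},
              {w ∈ K | T.graph.Adj z w}).Finite :=
            ih.biUnion fun z hz => Set.encard_lt_top_iff.1 (hdeg z hz.1 hz.2.1)
          refine (hfin.insert y).subset ?_
          rintro v ⟨hv, hyv, hvn⟩
          rcases hyv.eq_or_parent with rfl | hyv'
          · exact Or.inl rfl
          · have hvr : v ≠ T.root := by
              rintro rfl
              simp at hvn
            refine Or.inr (Set.mem_biUnion (x := T.parent v) ⟨hK v hv, hyv', ?_⟩
              ⟨hv, (T.adj_parent hvr).symm⟩)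
            rw [level_parent, hvn]
            rfl
      refine ((finite_ancestors (T := T) y).union (key n)).subset ?_
      rintro v ⟨hv | hv, hn⟩
      · exact Or.inl hv
      · exact Or.inr ⟨hv.1, hv.2, hn⟩
    · rintro p ⟨hp, ⟨k, rfl⟩, hpK⟩
      refine ⟨_, rfl, fun n => ?_⟩
      rcases le_total n k with hn | hn
      · exact Or.inl (hp.isAncestor hn)
      · exact Or.inr ⟨hpK n, hp.isAncestor hn⟩

end RootedTreeOn

/-! ### Charts between locally finite sets of rays and partwise stabilisers -/

section PStab

variable {X : Type u} {P : Set (Set X)}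

theorem IsUnboundedPartition.exists_injective_parts (hP : IsUnboundedPartition Cardinal.aleph0 P)
    (m : ℕ → ℕ) : ∃ C : ℕ → Set X, C.Injective ∧ ∀ n, C n ∈ P ∧ (m n : ℕ∞) ≤ (C n).encard := by
  have hfin : ∀ A ∈ P, A.Finite := fun A hA => Cardinal.lt_aleph0_iff_set_finite.1 (hP.2.1 A hA)
  have hex : ∀ k : ℕ, ∃ A ∈ P, k < A.ncard := by
    intro k
    obtain ⟨A, hA, h⟩ := hP.2.2 k (Cardinal.natCast_lt_aleph0)
    refine ⟨A, hA, ?_⟩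
    rw [← Set.cast_ncard (hfin A hA)] at h
    exact_mod_cast h
  choose A hA hk using hex
  -- `A k` has more than k elements, so the chosen parts strictly increase in size and are therefore
  -- distinct.
  let k : ℕ → ℕ := fun n => Nat.rec (m 0) (fun n k => max (m (n + 1)) (A k).ncard) n
  have hmono : StrictMono fun n => (A (k n)).ncard := strictMono_nat_of_lt_succ fun n =>
    (le_max_right (m (n + 1)) _).trans_lt (hk (k (n + 1)))
  refine ⟨fun n => A (k n), fun i j h => hmono.injective (congrArg Set.ncard h),
    fun n => ⟨hA _, ?_⟩⟩
  rw [← (hfin _ (hA _)).cast_ncard_eq, Nat.cast_le]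
  refine le_trans ?_ (hk _).le
  cases n with
  | zero => exact le_rfl
  | succ n => exact le_max_left _ _

theorem eq_of_mem_part (hP : Setoid.IsPartition P) {A B : Set X} (hA : A ∈ P) (hB : B ∈ P) {x : X}
    (hxA : x ∈ A) (hxB : x ∈ B) : A = B :=
  (hP.2 x).unique ⟨hA, hxA⟩ ⟨hB, hxB⟩

/-- Simultaneous transpositions in distinct parts. -/
theorem exists_mem_pStab (hP : Setoid.IsPartition P) {C : ℕ → Set X} (hC : C.Injective)
    (hCP : ∀ n, C n ∈ P) {a b : ℕ → X} (ha : ∀ n, a n ∈ C n) (hb : ∀ n, b n ∈ C n) :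
    ∃ f ∈ PStab P, ∀ n, f (a n) = some (b n) := by
  classical
  let s : X → X := fun x => if h : ∃ n, x ∈ C n then Equiv.swap (a h.choose) (b h.choose) x else x
  have hs : ∀ n x, x ∈ C n → s x = Equiv.swap (a n) (b n) x := by
    intro n x hx
    have h : ∃ n, x ∈ C n := ⟨n, hx⟩
    have : h.choose = n := hC (eq_of_mem_part hP (hCP _) (hCP _) h.choose_spec hx)
    simp only [s, dif_pos h]
    rw [this]
  have hs' : ∀ x, (¬ ∃ n, x ∈ C n) → s x = x := fun x h => dif_neg h
  have hmem : ∀ n x, x ∈ C n → s x ∈ C n := by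
    intro n x hx
    rw [hs n x hx, Equiv.swap_apply_def]
    split_ifs
    exacts [hb n, ha n, hx]
  have hinv : Function.Involutive s := by
    intro x
    by_cases h : ∃ n, x ∈ C n
    · obtain ⟨n, hn⟩ := h
      rw [hs n _ (hmem n x hn), hs n x hn, Equiv.swap_apply_self]
    · rw [hs' x h, hs' x h]
  have hA : ∀ A ∈ P, ∀ x ∈ A, s x ∈ A := by
    intro A hA x hx
    by_cases h : ∃ n, x ∈ C n
    · obtain ⟨n, hn⟩ := h
      obtain rfl := eq_of_mem_part hP hA (hCP n) hx hn
      exact hmem n x hn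
    · rwa [hs' x h]
  refine ⟨hinv.toPerm.toPEquiv, ⟨hinv.toPerm, fun A hAP => ?_, rfl⟩, fun n => ?_⟩
  · refine Set.Subset.antisymm ?_ fun x hx => ⟨s x, hA A hAP x hx, hinv x⟩
    rintro _ ⟨x, hx, rfl⟩
    exact hA A hAP x hx
  · rw [Equiv.toPEquiv_apply]
    change some (s (a n)) = _
    rw [hs n _ (ha n), Equiv.swap_apply_left]

end PStab

namespace RootedTreeOn

open SymInvMonoid

variable {X : Type u} {T : RootedTreeOn X}

/-- Level n of `H` is injected into its own part `C n`, which turns a ray in `H` into a transversal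
of these parts. An element of the stabiliser moves the base points `b n` to that transversal. Only
this element depends on the ray; the charts in `U` translate between `c`, `b` and `H`. -/
theorem exists_finite_charts_of_locallyFinite {P : Set (Set X)}
    (hP : IsUnboundedPartition Cardinal.aleph0 P) {c : ℕ → X} (hc : c.Injective) {H : Set X}
    (hH : ∀ n, {v ∈ H | T.level v = n}.Finite) :
    ∃ U : Set (SymInvMonoid X), U.Finite ∧ ∀ p, ∀ hp : T.IsRay p, (∀ n, p n ∈ H) →
      ofSeq c p hc hp.injective ∈ Subsemigroup.closure (PStab P ∪ U) ∧
      ofSeq p c hp.injective hc ∈ Subsemigroup.closure (PStab P ∪ U) := by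
  rcases isEmpty_or_nonempty X with hX | hX
  · exact hX.elim (c 0)
  obtain ⟨C, hCinj, hC⟩ := hP.exists_injective_parts fun n => {v ∈ H | T.level v = n}.ncard
  have hg : ∀ n, ∃ g : X → X, {v ∈ H | T.level v = n} ⊆ g ⁻¹' (C n) ∧
      Set.InjOn g {v ∈ H | T.level v = n} := by
    intro n
    refine (hH n).exists_injOn_of_encard_le ?_
    rw [← (hH n).cast_ncard_eq]
    exact (hC n).2
  choose g hgC hginj using hg
  have hκ : ∀ x ∈ H, ∀ y ∈ H, g (T.level x) x = g (T.level y) y → x = y := by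
    intro x hx y hy h
    have hl : T.level x = T.level y := hCinj (eq_of_mem_part hP.1 (hC _).1 (hC _).1
      (hgC _ ⟨hx, rfl⟩) (by rw [h]; exact hgC _ ⟨hy, rfl⟩))
    rw [← hl] at h
    exact hginj _ ⟨hx, rfl⟩ ⟨hy, hl.symm⟩ h
  have hb : ∀ n, ∃ b, b ∈ C n := by
    intro n
    refine Set.nonempty_iff_ne_empty.2 fun h => hP.1.1 ?_
    rw [← h]
    exact (hC n).1
  choose b hb using hb
  have hbinj : b.Injective := fun i j h =>
    hCinj (eq_of_mem_part hP.1 (hC _).1 (hC _).1 (hb i) (h ▸ hb j))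
  let k : SymInvMonoid X := ofRel (fun x y => x ∈ H ∧ g (T.level x) x = y)
    (fun x y z hy hz => hy.2.symm.trans hz.2)
    (fun x y z hx hy => hκ x hx.1 y hy.1 (hx.2.trans hy.2.symm))
  let l : SymInvMonoid X := ofRel (fun x y => y ∈ H ∧ g (T.level y) y = x)
    (fun x y z hx hy => hκ y hx.1 z hy.1 (hx.2.trans hy.2.symm))
    (fun x y z hy hz => hy.2.symm.trans hz.2)
  refine ⟨{ofSeq c b hc hbinj, ofSeq b c hbinj hc, k, l}, by simp, fun p hp hpH => ?_⟩
  set G := Subsemigroup.closure (PStab P ∪ {ofSeq c b hc hbinj, ofSeq b c hbinj hc, k, l})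
  have mem : ∀ g ∈ ({ofSeq c b hc hbinj, ofSeq b c hbinj hc, k, l} : Set (SymInvMonoid X)), g ∈ G :=
    fun g hg => Subsemigroup.subset_closure (Or.inr hg)
  have hgp : ∀ n, g n (p n) ∈ C n := fun n => hgC n ⟨hpH n, hp.level n⟩
  obtain ⟨σ, hσ, hσb⟩ := exists_mem_pStab hP.1 hCinj (fun n => (hC n).1) hb hgp
  obtain ⟨τ, hτ, hτb⟩ := exists_mem_pStab hP.1 hCinj (fun n => (hC n).1) hgp hb
  have h₁ : ofSeq c p hc hp.injective = ofSeq c b hc hbinj * σ * l := by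
    refine ext_iff_some fun x y => ?_
    simp only [mul_eq_some, ofSeq_eq_some, l, ofRel_eq_some]
    constructor
    · rintro ⟨n, rfl, rfl⟩
      exact ⟨_, ⟨_, ⟨n, rfl, rfl⟩, hσb n⟩, hpH n, by rw [hp.level]⟩
    · rintro ⟨z, ⟨_, ⟨n, rfl, rfl⟩, hz⟩, hy, hyz⟩
      rw [hσb, Option.some.injEq] at hz
      refine ⟨n, rfl, hκ _ (hpH n) _ hy ?_⟩
      rw [hp.level, hz, hyz]
  have h₂ : ofSeq p c hp.injective hc = k * τ * ofSeq b c hbinj hc := by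
    refine ext_iff_some fun x y => ?_
    simp only [mul_eq_some, ofSeq_eq_some, k, ofRel_eq_some]
    constructor
    · rintro ⟨n, rfl, rfl⟩
      exact ⟨b n, ⟨_, ⟨hpH n, rfl⟩, by rw [hp.level, hτb n]⟩, n, rfl, rfl⟩
    · rintro ⟨_, ⟨z, ⟨hx, rfl⟩, hz⟩, n, rfl, rfl⟩
      refine ⟨n, hκ _ (hpH n) _ hx (τ.inj_of_eq_some ?_ hz), rfl⟩
      rw [hp.level, hτb n]
  rw [h₁, h₂]
  have hS : ∀ f ∈ PStab P, f ∈ G := fun f hf => Subsemigroup.subset_closure (Or.inl hf)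
  exact ⟨mul_mem (mul_mem (mem _ (by simp)) (hS σ hσ)) (mem _ (by simp)),
    mul_mem (mul_mem (mem _ (by simp)) (hS τ hτ)) (mem _ (by simp))⟩

/-- Every chart between rays factors through the fixed sequence `c`. Each half needs the finitely
many charts of one covering set, and the countable union of these finite sets is absorbed. -/
theorem bsLe_pathBijections_pStab [Countable X] [Infinite X] {P : Set (Set X)}
    (hP : IsUnboundedPartition Cardinal.aleph0 P) (h : ¬ T.HasBranchingSubtree ⊤) :
    BSLe T.pathBijections (PStab P) := by
  obtain ⟨𝓗, hcount, hfin, hcover⟩ := exists_cover_of_not_hasBranchingSubtree_top h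
  let c := Infinite.natEmbedding X
  choose! U hU hUp using fun H (hH : H ∈ 𝓗) =>
    exists_finite_charts_of_locallyFinite hP c.injective (hfin H hH)
  have hV : (⋃ H ∈ 𝓗, U H).Countable := hcount.biUnion fun H hH => (hU H hH).countable
  refine bsLe_of_subset_closure_union (B' := ∅)
    (C := {f : SymInvMonoid X | (dom f).Finite} ∪ ⋃ H ∈ 𝓗, U H) ?_
    (BSLe.of_subset (Set.empty_subset _)) (countable_finite_dom.union hV)
  intro f hf
  rcases finite_dom_or_ofSeq_of_mem_pathBijections hf with h | ⟨p, q, hp, hq, rfl⟩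
  · exact Subsemigroup.subset_closure (Or.inr (Or.inl h))
  · have hsub : ∀ H ∈ 𝓗, PStab P ∪ U H ⊆
        PStab P ∪ ∅ ∪ ({f : SymInvMonoid X | (dom f).Finite} ∪ ⋃ H ∈ 𝓗, U H) := by
      rintro H hH g (hg | hg)
      · exact Or.inl (Or.inl hg)
      · exact Or.inr (Or.inr (Set.mem_biUnion hH hg))
    obtain ⟨H, hH, hpH⟩ := hcover p hp
    obtain ⟨H', hH', hqH⟩ := hcover q hq
    rw [← ofSeq_mul hp.injective c.injective hq.injective]
    exact mul_mem (Subsemigroup.closure_mono (hsub H hH) (hUp H hH p hp hpH).2)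
      (Subsemigroup.closure_mono (hsub H' hH') (hUp H' hH' q hq hqH).1)

end RootedTreeOn

/-! ### Families of rays in branching trees -/

theorem exists_seq_of_forall_exists {S : Type*} (P : ℕ → S → Prop) (r : ℕ → S → S → Prop)
    (h₀ : ∃ s, P 0 s) (h : ∀ n s, P n s → ∃ s', P (n + 1) s' ∧ r n s s') :
    ∃ f : ℕ → S, ∀ n, P n (f n) ∧ r n (f n) (f (n + 1)) := by
  obtain ⟨s₀, hs₀⟩ := h₀
  have : Nonempty S := ⟨s₀⟩
  choose! g hg hr using h
  let f : ℕ → S := fun n => Nat.rec s₀ (fun n s => g n s) n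
  have hf : ∀ n, P n (f n) := by
    intro n
    induction n with
    | zero => exact hs₀
    | succ n ih => exact hg n _ ih
  exact ⟨f, fun n => ⟨hf n, hr n _ (hf n)⟩⟩

namespace RootedTreeOn

variable {X : Type u} {T : RootedTreeOn X}

theorem IsAncestor.level_lt {x y : X} (h : T.IsAncestor x y) (hne : y ≠ x) :
    T.level x < T.level y :=
  h.level_le.lt_of_ne fun hl => hne (h.eq_of_level (.refl y) hl).symm

theorem anc_anc {x : X} {i j : ℕ} (hij : i ≤ j) (hj : j ≤ T.level x) :
    T.anc (T.anc x j) i = T.anc x i := by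
  exact ((isAncestor_anc x j).anc (by rwa [level_anc hj])).symm

theorem exists_isAncestor_level (h : ∀ x, ∃ y, T.IsAncestor x y ∧ y ≠ x) (x : X) {L : ℕ}
    (hL : T.level x ≤ L) : ∃ y, T.IsAncestor x y ∧ T.level y = L := by
  induction L, hL using Nat.le_induction with
  | base => exact ⟨x, .refl x, rfl⟩
  | succ L hL ih =>
    obtain ⟨y, hxy, rfl⟩ := ih
    obtain ⟨z, hyz, hne⟩ := h y
    have hlt := hyz.level_lt hne
    refine ⟨T.anc z (T.level y + 1), hxy.trans ?_, level_anc hlt⟩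
    refine IsAncestor.of_level_le hyz (isAncestor_anc _ _) ?_
    rw [level_anc hlt]
    omega

/-- Induction on `M`: below a branching vertex, one child supplies `M` descendants and another child
one more. -/
theorem exists_injective_descendants (hT : ∀ x, ∃ y, (T.IsAncestor x y ∧ y ≠ x) ∧
    ∃ u ∈ T.children y, ∃ v ∈ T.children y, u ≠ v) (M : ℕ) (x : X) :
    ∃ L₀, ∀ L ≥ L₀, ∃ e : Fin M → X, e.Injective ∧
      ∀ i, T.IsAncestor x (e i) ∧ T.level (e i) = L := by
  induction M generalizing x with
  | zero => exact ⟨0, fun L _ => ⟨Fin.elim0, fun i => i.elim0, fun i => i.elim0⟩⟩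
  | succ M ih =>
    obtain ⟨y, ⟨hxy, -⟩, u, hu, v, hv, huv⟩ := hT x
    obtain ⟨L₀, hL₀⟩ := ih u
    refine ⟨max L₀ (T.level v), fun L hL => ?_⟩
    obtain ⟨e, he, heu⟩ := hL₀ L ((le_max_left _ _).trans hL)
    obtain ⟨w, hw, hwL⟩ := exists_isAncestor_level (fun x => (hT x).imp fun _ h => h.1) v
      ((le_max_right _ _).trans hL)
    refine ⟨Fin.cons w e, Fin.cons_injective_iff.2 ⟨?_, he⟩, fun i => ?_⟩
    · rintro ⟨i, rfl⟩
      refine huv ((heu i).1.eq_of_level hw ?_)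
      rw [level_of_mem_children hu, level_of_mem_children hv]
    · refine Fin.cases ?_ (fun i => ?_) i
      · exact ⟨(hxy.trans (isAncestor_of_mem_children hv)).trans hw, hwL⟩
      · exact ⟨(hxy.trans (isAncestor_of_mem_children hu)).trans (heu i).1, (heu i).2⟩

theorem exists_separated_descendants (hT : ∀ x, ∃ y, (T.IsAncestor x y ∧ y ≠ x) ∧
    ∃ u ∈ T.children y, ∃ v ∈ T.children y, u ≠ v) (M b : ℕ) {A : Set X} (hA : A.Finite) (N : ℕ) :
    ∃ L ≥ N, ∀ x ∈ A, ∃ e : Fin M → X, (∀ i, T.IsAncestor x (e i) ∧ T.level (e i) = L + b) ∧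
      ∀ i j, T.anc (e i) L = T.anc (e j) L → i = j := by
  choose L₀ hL₀ using exists_injective_descendants hT M
  obtain ⟨L₁, hL₁⟩ := (hA.image L₀).bddAbove
  refine ⟨max N L₁, le_max_left _ _, fun x hx => ?_⟩
  obtain ⟨e, he, hex⟩ := hL₀ x (max N L₁) ((hL₁ ⟨x, hx, rfl⟩).trans (le_max_right _ _))
  choose d hd hdL using fun i => exists_isAncestor_level
    (fun x => (hT x).imp fun _ h => h.1) (e i) (L := max N L₁ + b) (by rw [(hex i).2]; omega)
  refine ⟨d, fun i => ⟨(hex i).1.trans (hd i), hdL i⟩, fun i j h => he ?_⟩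
  have : ∀ i, T.anc (d i) (max N L₁) = e i := fun i => by
    have := (hd i).anc_eq
    rwa [(hex i).2] at this
  rwa [this, this] at h

/-- Rays are labelled by digit sequences so that a vertex in the n-th window of levels, from `L n`
to `L n + b n`, reveals exactly the first n digits. Between windows the branches split according to
the next digit. -/
theorem exists_rays_of_binary (hT : ∀ x, ∃ y, (T.IsAncestor x y ∧ y ≠ x) ∧
    ∃ u ∈ T.children y, ∃ v ∈ T.children y, u ≠ v) (h b : ℕ → ℕ) :
    ∃ (L : ℕ → ℕ) (φ : (∀ n, Fin (h n)) → ℕ → X), (∀ c, T.IsRay (φ c)) ∧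
      (∀ n, L n + b n < L (n + 1)) ∧
      ∀ c d n j, j ≤ b n → (φ c (L n + j) = φ d (L n + j) ↔ ∀ i < n, c i = d i) := by
  -- A state is the start of the n-th window with, for every label, the vertex at its end.
  -- Finiteness of the range allows one next window for all labels.
  let P : ℕ → ℕ × ((∀ n, Fin (h n)) → X) → Prop := fun n s =>
    (Set.range s.2).Finite ∧ (∀ c, T.level (s.2 c) = s.1 + b n) ∧
    ∀ c d, ((∀ i < n, c i = d i) → s.2 c = s.2 d) ∧
      (T.anc (s.2 c) s.1 = T.anc (s.2 d) s.1 → ∀ i < n, c i = d i)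
  let r : ℕ → ℕ × ((∀ n, Fin (h n)) → X) → ℕ × ((∀ n, Fin (h n)) → X) → Prop := fun n s s' =>
    s.1 + b n < s'.1 ∧ ∀ c, T.IsAncestor (s.2 c) (s'.2 c)
  obtain ⟨f, hf⟩ : ∃ f : ℕ → ℕ × ((∀ n, Fin (h n)) → X),
      ∀ n, P n (f n) ∧ r n (f n) (f (n + 1)) := by
    refine exists_seq_of_forall_exists P r ?_ ?_
    · obtain ⟨y, -, hy⟩ := exists_isAncestor_level (fun x => (hT x).imp fun _ h => h.1) T.root
        (L := 0 + b 0) (by simp)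
      exact ⟨(0, fun _ => y), Set.finite_range_const, fun _ => hy,
        fun c d => ⟨fun _ => rfl, fun _ i hi => absurd hi (Nat.not_lt_zero i)⟩⟩
    · rintro n ⟨L, ν⟩ ⟨hfin, hlev, hν⟩
      simp only at hfin hlev hν
      obtain ⟨L', hL', he⟩ := exists_separated_descendants hT (h n) (b (n + 1)) hfin (L + b n + 1)
      choose! e he₁ he₂ using he
      refine ⟨(L', fun c => e (ν c) (c n)), ⟨?_, ?_, fun c d => ⟨fun hcd => ?_, fun hcd => ?_⟩⟩,
        hL', fun c => (he₁ (ν c) ⟨c, rfl⟩ (c n)).1⟩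
      · refine (hfin.biUnion fun x _ => Set.finite_range (e x)).subset ?_
        rintro _ ⟨c, rfl⟩
        exact Set.mem_biUnion (x := ν c) ⟨c, rfl⟩ ⟨c n, rfl⟩
      · exact fun c => (he₁ (ν c) ⟨c, rfl⟩ (c n)).2
      · have h₁ := (hν c d).1 fun i hi => hcd i (hi.trans (Nat.lt_succ_self n))
        simp only [h₁, hcd n (Nat.lt_succ_self n)]
      · simp only at hcd
        have key : ∀ c, T.anc (T.anc (e (ν c) (c n)) L') L = T.anc (ν c) L := fun c => by
          have := he₁ (ν c) ⟨c, rfl⟩ (c n)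
          rw [anc_anc (by omega) (by omega), this.1.anc (by rw [hlev]; omega)]
        have hlt : ∀ i < n, c i = d i := (hν c d).2 (by rw [← key, ← key, hcd])
        have hcn : c n = d n := by
          have h₁ := (hν c d).1 hlt
          rw [← h₁] at hcd
          exact he₂ (ν c) ⟨c, rfl⟩ _ _ hcd
        intro i hi
        rcases Nat.lt_succ_iff_lt_or_eq.1 hi with hi | rfl
        exacts [hlt i hi, hcn]
  have hL : ∀ n, (f n).1 + b n < (f (n + 1)).1 := fun n => (hf n).2.1
  have hLn : ∀ n, n ≤ (f n).1 := fun n => by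
    induction n with
    | zero => omega
    | succ n ih => have := hL n; omega
  have hlev : ∀ n c, T.level ((f n).2 c) = (f n).1 + b n := fun n c => (hf n).1.2.1 c
  have hanc : ∀ c m n, m ≤ n → T.IsAncestor ((f m).2 c) ((f n).2 c) := by
    intro c m n hmn
    induction n, hmn using Nat.le_induction with
    | base => exact .refl _
    | succ n _ ih => exact ih.trans ((hf n).2.2 c)
  have hφ : ∀ c n j, j ≤ b n → T.anc ((f ((f n).1 + j)).2 c) ((f n).1 + j) =
      T.anc ((f n).2 c) ((f n).1 + j) := fun c n j hj =>
    (hanc c n _ ((hLn n).trans (Nat.le_add_right _ _))).anc (by rw [hlev]; omega)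
  refine ⟨fun n => (f n).1, fun c j => T.anc ((f j).2 c) j, fun c => ?_, hL, ?_⟩
  · exact isRay_anc (fun n => (hf n).2.2 c) fun n => by
      rw [hlev]
      exact (hLn n).trans (Nat.le_add_right _ _)
  · intro c d n j hj
    simp only [hφ _ _ _ hj]
    constructor
    · intro h
      refine ((hf n).1.2.2 c d).2 ?_
      rw [← anc_anc (Nat.le_add_right _ j) (by rw [hlev]; omega), h,
        anc_anc (Nat.le_add_right _ j) (by rw [hlev]; omega)]
    · intro h
      rw [((hf n).1.2.2 c d).1 h]

/-- At the n-th branching vertex, `c n` selects a child and then forces the descent to a branching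
vertex of level at least `c n`. Thus a choice among infinitely many children announces the length of
the next block. The map `π` sends a vertex to the branching vertex ending its block, and is
finite-to-one because a vertex has finitely many ancestors. -/
theorem exists_rays_of_infinite_branching (hT : ∀ x, ∃ y, (T.IsAncestor x y ∧ y ≠ x) ∧
    (T.children y).Infinite) :
    ∃ (φ : (ℕ → ℕ) → ℕ → X) (M : (ℕ → ℕ) → ℕ → ℕ) (π : X → X), (∀ c, T.IsRay (φ c)) ∧
      (∀ z, {x | π x = z}.Finite) ∧ (∀ c d i, (∀ j < i, c j = d j) → M c i = M d i) ∧
      (∀ c, StrictMono (M c)) ∧ (∀ c i, c i ≤ M c (i + 1)) ∧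
      ∀ c j j', (∀ i, j < M c i ↔ j' < M c i) → π (φ c j) = π (φ c j') := by
  have hY : ∀ x K, ∃ y, T.IsAncestor x y ∧ K ≤ T.level y ∧ (T.children y).Infinite := by
    intro x K
    obtain ⟨y, hxy, hy⟩ := exists_isAncestor_level (fun x => (hT x).imp fun _ h => h.1) x
      (le_max_left (T.level x) K)
    obtain ⟨z, ⟨hyz, -⟩, hz⟩ := hT y
    exact ⟨z, hxy.trans hyz, (le_max_right _ _).trans (hy ▸ hyz.level_le), hz⟩
  choose Y hYanc hYlev hYinf using hY
  have hW : ∀ y, ∃ w : ℕ → X, (T.children y).Infinite →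
      w.Injective ∧ ∀ n, w n ∈ T.children y := by
    intro y
    by_cases h : (T.children y).Infinite
    · exact ⟨fun n => h.natEmbedding _ n,
        fun _ => ⟨Subtype.val_injective.comp (h.natEmbedding _).injective,
          fun n => (h.natEmbedding _ n).2⟩⟩
    · exact ⟨fun _ => y, fun h' => absurd h' h⟩
  choose W hW using hW
  let y : (ℕ → ℕ) → ℕ → X := fun c n =>
    Nat.rec (Y T.root 0) (fun n x => Y (W x (c n)) (c n)) n
  have hysucc : ∀ c n, y c (n + 1) = Y (W (y c n) (c n)) (c n) := fun c n => rfl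
  have hyinf : ∀ c n, (T.children (y c n)).Infinite := by
    intro c n
    cases n with
    | zero => exact hYinf _ _
    | succ n => exact hYinf _ _
  have hWchild : ∀ c n, W (y c n) (c n) ∈ T.children (y c n) := fun c n =>
    (hW _ (hyinf c n)).2 _
  have hWanc : ∀ c n, T.IsAncestor (W (y c n) (c n)) (y c (n + 1)) := fun c n => hYanc _ _
  have hyanc : ∀ c n, T.IsAncestor (y c n) (y c (n + 1)) := fun c n =>
    (isAncestor_of_mem_children (hWchild c n)).trans (hWanc c n)
  have hylt : ∀ c n, T.level (y c n) < T.level (y c (n + 1)) := fun c n => by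
    have := (hWanc c n).level_le
    rw [level_of_mem_children (hWchild c n)] at this
    omega
  have hymono : ∀ c, StrictMono fun n => T.level (y c n) := fun c =>
    strictMono_nat_of_lt_succ (hylt c)
  have hyn : ∀ c n, n ≤ T.level (y c n) := fun c n => (hymono c).le_apply
  have hyanc' : ∀ c {m n}, m ≤ n → T.IsAncestor (y c m) (y c n) := by
    intro c m n hmn
    induction n, hmn using Nat.le_induction with
    | base => exact .refl _
    | succ n _ ih => exact ih.trans (hyanc c n)
  have hydep : ∀ c d i, (∀ j < i, c j = d j) → y c i = y d i := by
    intro c d i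
    induction i with
    | zero => exact fun _ => rfl
    | succ i ih =>
      intro h
      rw [hysucc, hysucc, ih fun j hj => h j (hj.trans (Nat.lt_succ_self i)),
        h i (Nat.lt_succ_self i)]
  let Q : X → X → Prop := fun v z => ∃ c n, T.level v ≤ T.level (y c n) ∧
    (∀ m < n, T.level (y c m) < T.level v) ∧ T.IsAncestor v (y c n) ∧ y c n = z
  -- The end of the block of v does not depend on the ray: the ancestors of v show which children
  -- were chosen, hence, by injectivity of `W`, all digits up to that block.
  have hQle : ∀ v c n d m, n ≤ m → T.level v ≤ T.level (y c n) →
      (∀ k < n, T.level (y c k) < T.level v) → T.IsAncestor v (y c n) →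
      (∀ k < m, T.level (y d k) < T.level v) → T.IsAncestor v (y d m) → y c n = y d m := by
    intro v c n d m hnm h₁ h₂ h₃ h₅ h₆
    have key : ∀ k ≤ n, y c k = y d k := by
      intro k
      induction k with
      | zero => exact fun _ => rfl
      | succ k ih =>
        intro hk
        have ih := ih (by omega)
        have hanc : ∀ c n, k + 1 ≤ n → T.level (y c k) < T.level v → T.IsAncestor v (y c n) →
            T.IsAncestor (W (y c k) (c k)) v := fun c n hk hl hv =>
          IsAncestor.of_level_le ((hWanc c k).trans (hyanc' c hk)) hv (by
            rw [level_of_mem_children (hWchild c k)]; exact hl)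
        have hc := hanc c n hk (h₂ k hk) h₃
        have hd := hanc d m (hk.trans hnm) (h₅ k (by omega)) h₆
        have heq : W (y c k) (c k) = W (y d k) (d k) := hc.eq_of_level hd (by
          rw [level_of_mem_children (hWchild c k), level_of_mem_children (hWchild d k), ih])
        rw [ih] at heq
        rw [hysucc, hysucc, ih, (hW _ (hyinf d k)).1 heq]
    rcases hnm.lt_or_eq with hlt | rfl
    · have := h₅ n hlt
      rw [← key n le_rfl] at this
      omega
    · exact key n le_rfl
  have hQ : ∀ v z z', Q v z → Q v z' → z = z' := by
    rintro v _ _ ⟨c, n, h₁, h₂, h₃, rfl⟩ ⟨d, m, h₄, h₅, h₆, rfl⟩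
    rcases le_total n m with h | h
    · exact hQle v c n d m h h₁ h₂ h₃ h₅ h₆
    · exact (hQle v d m c n h h₄ h₅ h₆ h₂ h₃).symm
  have hπex : ∀ v, ∃ w, (∀ z, Q v z → w = z) ∧ T.IsAncestor v w := by
    intro v
    rcases Classical.em (∃ z, Q v z) with h | h
    · obtain ⟨z, hz⟩ := h
      refine ⟨z, fun z' hz' => hQ v z z' hz hz', ?_⟩
      obtain ⟨c, n, -, -, h₃, rfl⟩ := hz
      exact h₃
    · exact ⟨v, fun z hz => absurd ⟨z, hz⟩ h, .refl v⟩
  choose π hπ hπanc using hπex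
  have hφ : ∀ c, T.IsRay fun j => T.anc (y c j) j := fun c => isRay_anc (hyanc c) (hyn c)
  refine ⟨fun c j => T.anc (y c j) j, fun c n => T.level (y c n) + 1, π, hφ,
    fun z => (finite_ancestors (T := T) z).subset fun x hx => ?_, fun c d i h => ?_,
    fun c i j hij => ?_, fun c i => ?_, fun c j j' hjj => ?_⟩
  · have := hπanc x
    rwa [show π x = z from hx] at this
  · simp only [hydep c d i h]
  · exact Nat.succ_lt_succ (hymono c hij)
  · exact (hYlev _ _).trans (Nat.le_succ _)
  · have hex : ∃ n, j ≤ T.level (y c n) := ⟨j, hyn c j⟩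
    have key : ∀ j, j ≤ T.level (y c (Nat.find hex)) →
        (∀ m < Nat.find hex, T.level (y c m) < j) →
        Q (T.anc (y c j) j) (y c (Nat.find hex)) := by
      intro j h₁ h₂
      have hl : T.level (T.anc (y c j) j) = j := (hφ c).level j
      refine ⟨c, Nat.find hex, by rwa [hl], by rwa [hl], ?_, rfl⟩
      have : T.anc (y c j) j = T.anc (y c (Nat.find hex)) j := by
        rcases le_total j (Nat.find hex) with h | h
        · exact ((hyanc' c h).anc (hyn c j)).symm
        · exact (hyanc' c h).anc h₁
      rw [this]
      exact isAncestor_anc _ _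
    have h₁ := Nat.find_spec hex
    have h₂ : ∀ m < Nat.find hex, T.level (y c m) < j := fun m hm =>
      not_le.1 (Nat.find_min hex hm)
    rw [hπ _ _ (key j h₁ h₂), hπ _ _ (key j' ?_ fun m hm => ?_)]
    · exact Nat.lt_succ_iff.1 ((hjj _).1 (Nat.lt_succ_iff.2 h₁))
    · by_contra hlt
      have := (hjj m).2 (Nat.lt_succ_iff.2 (not_lt.1 hlt))
      exact absurd (h₂ m hm) (not_lt.2 (Nat.lt_succ_iff.1 this))

/-! #### Transfer from subtrees -/

theorem HasBranchingSubtree.mono {d e : ℕ∞} (hde : d ≤ e) (h : T.HasBranchingSubtree e) :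
    T.HasBranchingSubtree d := by
  obtain ⟨S, hS⟩ := h
  exact ⟨S, fun x => (hS x).imp fun y hy => ⟨hy.1, hde.trans hy.2⟩⟩

theorem exists_rays_of_hasBranchingSubtree_three (hT : T.HasBranchingSubtree 3) (h b : ℕ → ℕ) :
    ∃ (L : ℕ → ℕ) (φ : (∀ n, Fin (h n)) → ℕ → X), (∀ c, T.IsRay (φ c)) ∧
      (∀ n, L n + b n < L (n + 1)) ∧
      ∀ c d n j, j ≤ b n → (φ c (L n + j) = φ d (L n + j) ↔ ∀ i < n, c i = d i) := by
  obtain ⟨S, hS⟩ := hT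
  obtain ⟨L, φ, hφ, hL, heq⟩ := exists_rays_of_binary (T := S.toRootedTree) (fun x => by
    obtain ⟨y, hy, hd⟩ := hS x
    rw [isDescendant_iff] at hy
    exact ⟨y, hy.symm, exists_pair_of_three_le_degree hd⟩) h b
  exact ⟨L, fun c n => φ c n, fun c => (hφ c).of_subtree, hL, fun c d n j hj => by
    rw [← heq c d n j hj, Subtype.coe_inj]⟩

theorem exists_rays_of_hasBranchingSubtree_top (hT : T.HasBranchingSubtree ⊤) :
    ∃ (φ : (ℕ → ℕ) → ℕ → X) (M : (ℕ → ℕ) → ℕ → ℕ) (π : X → X), (∀ c, T.IsRay (φ c)) ∧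
      (∀ z, {x | π x = z}.Finite) ∧ (∀ c d i, (∀ j < i, c j = d j) → M c i = M d i) ∧
      (∀ c, StrictMono (M c)) ∧ (∀ c i, c i ≤ M c (i + 1)) ∧
      ∀ c j j', (∀ i, j < M c i ↔ j' < M c i) → π (φ c j) = π (φ c j') := by
  classical
  obtain ⟨S, hS⟩ := hT
  obtain ⟨φ, M, π, hφ, hπ, h₁, h₂, h₃, h₄⟩ :=
    exists_rays_of_infinite_branching (T := S.toRootedTree) (fun x => by
      obtain ⟨y, hy, hd⟩ := hS x
      rw [isDescendant_iff] at hy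
      exact ⟨y, hy.symm, infinite_children_of_degree_eq_top hd⟩)
  -- Extending by the identity adds at most the point z to the fibre over z.
  refine ⟨fun c n => φ c n, M, fun x => if h : x ∈ S.subgraph.verts then π ⟨x, h⟩ else x,
    fun c => (hφ c).of_subtree, fun z => ?_, h₁, h₂, h₃, fun c j j' hj => ?_⟩
  · have hfin : {x : S.subgraph.verts | (π x : X) = z}.Finite := by
      by_cases hz : z ∈ S.subgraph.verts
      · exact (hπ ⟨z, hz⟩).subset fun x hx => Subtype.ext hx
      · refine Set.finite_empty.subset fun x hx => hz ?_
        rw [← show (π x : X) = z from hx]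
        exact (π x).2
    refine ((hfin.image Subtype.val).insert z).subset fun x hx => ?_
    change (if h : x ∈ S.subgraph.verts then (π ⟨x, h⟩ : X) else x) = z at hx
    split_ifs at hx with h
    · exact Or.inr ⟨⟨x, h⟩, hx, rfl⟩
    · exact Or.inl hx
  · simp only [Subtype.coe_prop, dif_pos]
    exact congrArg Subtype.val (h₄ c j j' hj)

theorem not_countable_rootedPaths [Countable X] (hT : T.HasBranchingSubtree 3) :
    ¬ T.rootedPaths.Countable := by
  rw [countable_rootedPaths_iff]
  intro hc
  obtain ⟨L, φ, hφ, hL, heq⟩ :=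
    exists_rays_of_hasBranchingSubtree_three hT (fun _ => 2) (fun _ => 0)
  have hinj : φ.Injective := fun c d h => funext fun i =>
    (heq c d (i + 1) 0 le_rfl).1 (congrFun h _) i (Nat.lt_succ_self i)
  have : Countable (ℕ → Fin 2) :=
    Set.countable_univ_iff.1 ((hc.preimage hinj).mono fun c _ => hφ c)
  obtain ⟨f, hf⟩ := exists_surjective_nat (ℕ → Fin 2)
  -- Cantor's diagonal argument in `Fin 2`, where adding 1 flips the digit.
  obtain ⟨n, hn⟩ := hf fun i => f i i + 1
  have := congrFun hn n
  revert this
  generalize f n n = a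
  revert a
  decide

end RootedTreeOn

/-! ### Charts that respect a finite-to-one map -/

namespace SymInvMonoid

variable {X : Type u}

/-- The charts that preserve the fibres of a map. -/
def fibrewise {ι : Type*} (π : X → ι) : Set (SymInvMonoid X) :=
  {f | ∀ x y, f x = some y → π x = π y}

theorem pStab_subset_fibrewise {P : Set (Set X)} (hP : IsUnboundedPartition Cardinal.aleph0 P) :
    ∃ π : X → X, (∀ z, {x | π x = z}.Finite) ∧ PStab P ⊆ fibrewise π := by
  choose A hA _ using hP.1.2
  have hex : ∀ B : Set X, ∃ x : X → X, ∀ y ∈ B, x y ∈ B ∧ ∀ z ∈ B, x y = x z := fun B => by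
    rcases B.eq_empty_or_nonempty with rfl | ⟨x, hx⟩
    · exact ⟨id, by simp⟩
    · exact ⟨fun _ => x, fun y _ => ⟨hx, fun _ _ => rfl⟩⟩
  choose r hr using hex
  refine ⟨fun x => r (A x) x, fun z => ?_, ?_⟩
  · refine (Cardinal.lt_aleph0_iff_set_finite.1 (hP.2.1 (A z) (hA z).1)).subset ?_
    intro x hx
    have h₁ := (hr (A x) x (hA x).2).1
    rw [show r (A x) x = z from hx] at h₁
    rw [← eq_of_mem_part hP.1 (hA x).1 (hA z).1 h₁ (hA z).2]
    exact (hA x).2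
  · rintro _ ⟨σ, hσ, rfl⟩ x y h
    obtain rfl : σ x = y := by simpa using h
    have hmem : σ x ∈ A x := by
      rw [← hσ (A x) (hA x).1]
      exact ⟨x, (hA x).2, rfl⟩
    have : A (σ x) = A x := eq_of_mem_part hP.1 (hA _).1 (hA x).1 (hA _).2 hmem
    change r (A x) x = r (A (σ x)) (σ x)
    rw [this]
    exact (hr (A x) x (hA x).2).2 _ hmem

end SymInvMonoid

namespace RootedTreeOn

open SymInvMonoid

variable {X : Type u} {T : RootedTreeOn X}

/-- The n-th digit of the label of f codes the graph of f on the n-th fibre. A point x is placed at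
level `τ x` of the ray of f, in a window late enough to reveal the digit of its own fibre. -/
theorem bsLe_fibrewise_nat [Countable X] (hT : T.HasBranchingSubtree 3) {π : X → ℕ}
    (hπ : ∀ n, {x | π x = n}.Finite) : BSLe (fibrewise π) T.pathBijections := by
  obtain ⟨e, he⟩ := exists_injective_nat X
  have hB : ∀ n, ∃ b, ∀ x, π x = n → e x ≤ b := fun n => by
    obtain ⟨b, hb⟩ := ((hπ n).image e).bddAbove
    exact ⟨b, fun x hx => hb ⟨x, hx, rfl⟩⟩
  choose b hb using hB
  let B : ℕ → Set X := fun n => {x | π x = n}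
  have hF : ∀ n, ∃ k, Nonempty (𝒫 (B n ×ˢ B n) ≃ Fin k) := fun n => by
    have : Finite (𝒫 (B n ×ˢ B n)) := ((hπ n).prod (hπ n)).powerset.to_subtype
    exact ⟨_, ⟨Finite.equivFin _⟩⟩
  choose h code using hF
  have code := fun n => (code n).some
  -- Fibre n is placed in window n + 1, the first to reveal digit n; hence the shift in the window
  -- lengths.
  obtain ⟨L, φ, hφ, hL, hLφ⟩ := exists_rays_of_hasBranchingSubtree_three hT h fun n => b (n - 1)
  let R : ℕ → SymInvMonoid X → Set (X × X) := fun n f =>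
    {z | (π z.1 = n ∧ π z.2 = n) ∧ f z.1 = some z.2}
  have hR : ∀ n f, R n f ∈ 𝒫 (B n ×ˢ B n) := fun n f z hz => hz.1
  let c : SymInvMonoid X → ∀ n, Fin (h n) := fun f n => code n ⟨R n f, hR n f⟩
  have hc : ∀ n f g, c f n = c g n → R n f = R n g := fun n f g h =>
    congrArg Subtype.val ((code n).injective h)
  let q : SymInvMonoid X → ℕ → X := fun f => φ (c f)
  have hq : ∀ f, T.IsRay (q f) := fun f => hφ _
  let τ : X → ℕ := fun x => L (π x + 1) + e x
  have hLmono : StrictMono L := strictMono_nat_of_lt_succ fun n =>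
    (Nat.le_add_right _ _).trans_lt (hL n)
  have hτlt : ∀ x y, π x < π y → τ x < τ y := by
    intro x y hxy
    have h₁ : τ x ≤ L (π x + 1) + b (π x) := Nat.add_le_add_left (hb _ x rfl) _
    have h₂ : L (π x + 1) + b (π x) < L (π x + 1 + 1) := hL (π x + 1)
    have h₃ : L (π x + 1 + 1) ≤ L (π y + 1) := hLmono.monotone (by omega)
    exact (h₁.trans_lt h₂).trans_le (h₃.trans (Nat.le_add_right _ _))
  have hτ : τ.Injective := by
    intro x y hxy
    rcases lt_trichotomy (π x) (π y) with hlt | heq | hlt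
    · exact absurd hxy (hτlt x y hlt).ne
    · refine he ?_
      simp only [τ, heq] at hxy
      omega
    · exact absurd hxy (hτlt y x hlt).ne'
  have hqτ : ∀ f g x, q f (τ x) = q g (τ x) ↔ ∀ i < π x + 1, c f i = c g i := fun f g x =>
    hLφ (c f) (c g) (π x + 1) (e x) (hb _ x rfl)
  have hqτ' : ∀ f g x x', q f (τ x) = q g (τ x') → x = x' ∧ ∀ i < π x + 1, c f i = c g i := by
    intro f g x x' h
    obtain rfl := hτ ((hq f).eq_of_eq (hq g) h)
    exact ⟨rfl, (hqτ f g x).1 h⟩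
  have hfg : ∀ f ∈ fibrewise π, ∀ g x y, (∀ i < π x + 1, c f i = c g i) → f x = some y →
      g x = some y := by
    intro f hf g x y h hxy
    have hmem : (x, y) ∈ R (π x) f := ⟨⟨rfl, (hf x y hxy).symm⟩, hxy⟩
    rw [hc _ f g (h _ (Nat.lt_succ_self _))] at hmem
    exact hmem.2
  -- The universal chart. It is well defined because `q f (τ x)` determines x and f on the fibre of
  -- x; it is injective because x and `f x` share a fibre.
  let k : SymInvMonoid X := ofRel
    (fun u v => ∃ f ∈ fibrewise π, ∃ x y, f x = some y ∧ q f (τ x) = u ∧ q f (τ y) = v)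
    (by
      rintro _ _ _ ⟨f, hf, x, y, hxy, rfl, rfl⟩ ⟨g, hg, x', y', hxy', heq, rfl⟩
      obtain ⟨rfl, hcfg⟩ := hqτ' _ _ _ _ heq
      have := hfg g hg f x' y' hcfg hxy'
      rw [hxy, Option.some.injEq] at this
      subst this
      rw [hqτ, ← hf _ _ hxy]
      exact fun i hi => (hcfg i hi).symm)
    (by
      rintro _ _ _ ⟨f, hf, x, y, hxy, rfl, rfl⟩ ⟨g, hg, x', y', hxy', rfl, heq⟩
      obtain ⟨rfl, hcfg⟩ := hqτ' _ _ _ _ heq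
      rw [← hg _ _ hxy'] at hcfg
      have := hfg g hg f x' y' hcfg hxy'
      rw [f.inj_of_eq_some hxy this, hqτ]
      exact fun i hi => (hcfg i hi).symm)
  let p := q 1
  have hp : T.IsRay p := hq 1
  have hpτ : Function.Injective fun x => p (τ x) := hp.injective.comp hτ
  let a := ofSeq id (fun x => p (τ x)) Function.injective_id hpτ
  let a' := ofSeq (fun x => p (τ x)) id hpτ Function.injective_id
  refine ⟨{a, a', k}, by simp, fun f hf => ?_⟩
  have : f = a * ofSeq p (q f) hp.injective (hq f).injective * k *
      ofSeq (q f) p (hq f).injective hp.injective * a' := by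
    refine ext_iff_some fun x y => ?_
    simp only [mul_eq_some, ofSeq_eq_some, a, a', k, ofRel_eq_some]
    constructor
    · intro hxy
      exact ⟨p (τ y), ⟨q f (τ y), ⟨q f (τ x), ⟨p (τ x), ⟨x, rfl, rfl⟩, τ x, rfl, rfl⟩,
        f, hf, x, y, hxy, rfl, rfl⟩, τ y, rfl, rfl⟩, y, rfl, rfl⟩
    · rintro ⟨_, ⟨_, ⟨_, ⟨_, ⟨x, rfl, rfl⟩, i, hi, rfl⟩, g, hg, x', y', hxy, h₁, rfl⟩, j, hj, rfl⟩,
        z, hz, rfl⟩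
      rw [hp.injective hi] at h₁
      obtain ⟨rfl, hcfg⟩ := hqτ' _ _ _ _ h₁
      obtain rfl := (hq f).eq_of_eq (hq g) hj
      rw [hτ (hp.injective hz)]
      exact hfg g hg f _ _ hcfg hxy
  rw [SetLike.mem_coe, this]
  have mem : ∀ g ∈ ({a, a', k} : Set (SymInvMonoid X)),
      g ∈ Subsemigroup.closure (T.pathBijections ∪ {a, a', k}) :=
    fun g hg => Subsemigroup.subset_closure (Or.inr hg)
  exact mul_mem (mul_mem (mul_mem (mul_mem (mem _ (by simp))
    (Subsemigroup.subset_closure (Or.inl (hp.ofSeq_mem (hq f))))) (mem _ (by simp)))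
    (Subsemigroup.subset_closure (Or.inl ((hq f).ofSeq_mem hp)))) (mem _ (by simp))

theorem bsLe_fibrewise [Countable X] (hT : T.HasBranchingSubtree 3) {π : X → X}
    (hπ : ∀ z, {x | π x = z}.Finite) : BSLe (fibrewise π) T.pathBijections := by
  obtain ⟨e, he⟩ := exists_injective_nat X
  refine (BSLe.of_subset fun f hf x y hxy => ?_).trans
    (bsLe_fibrewise_nat hT (π := fun x => e (π x)) fun n => ?_)
  · exact congrArg e (hf x y hxy)
  · rcases Classical.em (∃ z, e z = n) with ⟨z, rfl⟩ | hn
    · exact (hπ z).subset fun x hx => he hx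
    · exact Set.finite_empty.subset fun x hx => hn ⟨_, hx⟩

theorem bsLe_pStab_pathBijections [Countable X] {P : Set (Set X)}
    (hP : IsUnboundedPartition Cardinal.aleph0 P) (hT : T.HasBranchingSubtree 3) :
    BSLe (PStab P) T.pathBijections := by
  obtain ⟨π, hπ, hsub⟩ := pStab_subset_fibrewise hP
  exact (BSLe.of_subset hsub).trans (bsLe_fibrewise hT hπ)

end RootedTreeOn

/-! ### Trees with infinite branching -/

/-- Course-of-values recursion, for functionals that take a whole sequence but consult only its
earlier terms. -/
theorem exists_eq_of_forall_eq_of_lt (Ψ : ℕ → (ℕ → ℕ) → ℕ)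
    (hΨ : ∀ n e e', (∀ m < n, e m = e' m) → Ψ n e = Ψ n e') : ∃ e : ℕ → ℕ, ∀ n, e n = Ψ n e := by
  let s : ℕ → ℕ → ℕ := fun n => Nat.rec (fun _ => 0) (fun n e => Function.update e n (Ψ n e)) n
  have hs : ∀ n, s (n + 1) = Function.update (s n) n (Ψ n (s n)) := fun n => rfl
  have key : ∀ m n, m < n → s n m = s (m + 1) m := by
    intro m n hmn
    induction n, hmn using Nat.le_induction with
    | base => rfl
    | succ n hn ih => rw [hs, Function.update_of_ne (by omega), ih]
  refine ⟨fun n => s (n + 1) n, fun n => ?_⟩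
  simp only
  rw [hs n, Function.update_self]
  exact hΨ n _ _ fun m hm => key m n hm

/-- If `M c i` depends on the first `i` terms of `c` only, then there are sequences `c` and `d`
whose associated sequences `M c` and `M d` are interleaved and grow as fast as desired. -/
theorem exists_interleaved (M : (ℕ → ℕ) → ℕ → ℕ)
    (hM : ∀ c d i, (∀ j < i, c j = d j) → M c i = M d i) (β : ℕ → ℕ) :
    ∃ c d : ℕ → ℕ, ∀ i, c i = β (M d i) ∧ d i = β (M c (i + 1)) := by
  -- The sequences `c` and `d` are the even and odd terms of one recursively defined sequence.
  obtain ⟨e, he⟩ := exists_eq_of_forall_eq_of_lt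
    (fun n e => if n % 2 = 0 then β (M (fun j => e (2 * j + 1)) (n / 2))
      else β (M (fun j => e (2 * j)) (n / 2 + 1))) (by
    intro n e e' h
    split_ifs with hn
    · rw [hM _ _ _ fun j hj => h (2 * j + 1) (by omega)]
    · rw [hM _ _ _ fun j hj => h (2 * j) (by omega)])
  refine ⟨fun j => e (2 * j), fun j => e (2 * j + 1), fun i => ⟨?_, ?_⟩⟩
  · simp only
    rw [he (2 * i), if_pos (by omega), Nat.mul_div_cancel_left i (by omega)]
  · simp only
    rw [he (2 * i + 1), if_neg (by omega), show (2 * i + 1) / 2 = i by omega]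

/-- A partial injection moves each point across the terms of at most one of two fast interleaved
sequences. -/
theorem exists_interleaved_blocks (M : (ℕ → ℕ) → ℕ → ℕ)
    (hM : ∀ c d i, (∀ j < i, c j = d j) → M c i = M d i) (hmono : ∀ c, StrictMono (M c))
    (hle : ∀ c i, c i ≤ M c (i + 1)) (ρ : ℕ → ℕ → Prop) (h₁ : ∀ i j k, ρ i j → ρ i k → j = k)
    (h₂ : ∀ i j k, ρ i k → ρ j k → i = j) (h₀ : ∀ c i j, ρ i j → M c 0 ≤ i ∧ M c 0 ≤ j) :
    ∃ c d : ℕ → ℕ, ∀ i j, ρ i j →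
      (∀ k, i < M c k ↔ j < M c k) ∨ (∀ k, i < M d k ↔ j < M d k) := by
  have hu : ∀ i, ∃ u, ∀ j, ρ i j → j < u := fun i => by
    rcases Classical.em (∃ j, ρ i j) with ⟨j, hj⟩ | h
    · exact ⟨j + 1, fun k hk => (h₁ i j k hj hk) ▸ Nat.lt_succ_self j⟩
    · exact ⟨0, fun j hj => absurd ⟨j, hj⟩ h⟩
  have hw : ∀ j, ∃ w, ∀ i, ρ i j → i < w := fun j => by
    rcases Classical.em (∃ i, ρ i j) with ⟨i, hi⟩ | h
    · exact ⟨i + 1, fun k hk => (h₂ i k j hi hk) ▸ Nat.lt_succ_self i⟩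
    · exact ⟨0, fun i hi => absurd ⟨i, hi⟩ h⟩
  choose u hu using hu
  choose w hw using hw
  -- `β a` bounds all partners under `ρ` of points below a. If a term of one sequence separates i
  -- from j, both lie below the next term of the other, so no later term separates them. The initial
  -- terms separate nothing, by `h₀`.
  let β : ℕ → ℕ := fun a => ∑ k ∈ Finset.range a, (u k + w k)
  have hβmono : Monotone β := fun a b hab =>
    Finset.sum_le_sum_of_subset (Finset.range_subset_range.2 hab)
  have hβ : ∀ a k, k < a → u k + w k ≤ β a := fun a k hk =>
    Finset.single_le_sum (f := fun k => u k + w k) (fun _ _ => Nat.zero_le _) (Finset.mem_range.2 hk)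
  obtain ⟨c, d, hcd⟩ := exists_interleaved M hM β
  have hc : ∀ i, β (M d i) ≤ M c (i + 1) := fun i => (hcd i).1 ▸ hle c i
  have hd : ∀ i, β (M c (i + 1)) ≤ M d (i + 1) := fun i => (hcd i).2 ▸ hle d i
  have cross : ∀ i j A B, ρ i j → ¬ (i < A ↔ j < A) → β A ≤ B → i < B ∧ j < B := by
    intro i j A B hij hA hAB
    have hi := hu i j hij
    have hj := hw j i hij
    rcases lt_or_ge i A with h | h
    · have := hβ A i h
      have : ¬ j < A := fun h' => hA (iff_of_true h h')
      omega
    · have hjA : j < A := by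
        by_contra h'
        exact hA (iff_of_false (by omega) h')
      have := hβ A j hjA
      omega
  refine ⟨c, d, fun i j hij => ?_⟩
  by_contra hcon
  push Not at hcon
  obtain ⟨⟨k, hk⟩, l, hl⟩ := hcon
  have hk' : ¬ (i < M c k ↔ j < M c k) := by
    intro h; rcases hk with h' | h' <;> omega
  have hl' : ¬ (i < M d l ↔ j < M d l) := by
    intro h; rcases hl with h' | h' <;> omega
  have hpos : ∀ c k, ¬ (i < M c k ↔ j < M c k) → ∃ k', k = k' + 1 := by
    intro c k h
    rcases k with _ | k
    · have := h₀ c i j hij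
      exact absurd (iff_of_false (by omega) (by omega)) h
    · exact ⟨k, rfl⟩
  obtain ⟨k, rfl⟩ := hpos c k hk'
  obtain ⟨l, rfl⟩ := hpos d l hl'
  rcases le_or_gt k l with hkl | hkl
  · have := cross i j _ (M d (l + 1)) hij hk'
      ((hβmono ((hmono c).monotone (Nat.succ_le_succ hkl))).trans (hd l))
    exact hl' (iff_of_true this.1 this.2)
  · have := cross i j _ (M c (k + 1)) hij hl'
      ((hβmono ((hmono d).monotone hkl)).trans (hc k))
    exact hk' (iff_of_true this.1 this.2)

namespace RootedTreeOn

open SymInvMonoid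

variable {X : Type u} {T : RootedTreeOn X}

/-- Transporting `G` from the ray `p` to the ray `q` makes it preserve the fibres of `π`, and both
passages are path-bijections. -/
theorem mem_closure_of_fibrewise {A : Set (SymInvMonoid X)} {p q : ℕ → X} (hp : T.IsRay p)
    (hq : T.IsRay q) {π : X → X} (hA : T.pathBijections ⊆ A) (hπA : fibrewise π ⊆ A)
    {G : SymInvMonoid X}
    (hG : ∀ x y, G x = some y → ∃ i j, p i = x ∧ p j = y ∧ π (q i) = π (q j)) :
    G ∈ Subsemigroup.closure A := by
  set a := ofSeq p q hp.injective hq.injective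
  set a' := ofSeq q p hq.injective hp.injective
  have hmem : a' * G * a ∈ fibrewise π := by
    intro u v huv
    simp only [mul_eq_some, ofSeq_eq_some, a, a'] at huv
    obtain ⟨_, ⟨_, ⟨i, rfl, rfl⟩, h⟩, j, rfl, rfl⟩ := huv
    obtain ⟨i', j', hi, hj, hπ⟩ := hG _ _ h
    rwa [hp.injective hi, hp.injective hj] at hπ
  have : G = a * (a' * G * a) * a' := by
    refine ext_iff_some fun x y => ?_
    simp only [mul_eq_some, ofSeq_eq_some, a, a']
    constructor
    · intro h
      obtain ⟨i, j, rfl, rfl, -⟩ := hG x y h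
      exact ⟨q j, ⟨q i, ⟨i, rfl, rfl⟩, p j, ⟨p i, ⟨i, rfl, rfl⟩, h⟩, j, rfl, rfl⟩, j, rfl, rfl⟩
    · rintro ⟨_, ⟨_, ⟨i, rfl, rfl⟩, _, ⟨_, ⟨i', hi', rfl⟩, h⟩, j, rfl, rfl⟩, j', hj', rfl⟩
      rwa [← hq.injective hi', hq.injective hj']
  rw [this]
  exact mul_mem (mul_mem (Subsemigroup.subset_closure (hA (hp.ofSeq_mem hq)))
    (Subsemigroup.subset_closure (hπA hmem)))
    (Subsemigroup.subset_closure (hA (hq.ofSeq_mem hp)))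

theorem bsLe_univ_pathBijections [Countable X] [Infinite X] (hT : T.HasBranchingSubtree ⊤) :
    BSLe (Set.univ : Set (SymInvMonoid X)) T.pathBijections := by
  obtain ⟨φ, M, π, hφ, hπ, hM, hmono, hle, hblock⟩ := exists_rays_of_hasBranchingSubtree_top hT
  obtain ⟨e, he⟩ := exists_injective_nat X
  set p := φ fun _ => 0
  have hp : T.IsRay p := hφ _
  let m := M (fun _ => 0) 0
  have hm : ∀ c, M c 0 = m := fun c => hM _ _ _ fun j hj => absurd hj (Nat.not_lt_zero j)
  have hα : Function.Injective fun x => p (2 * (e x + m)) := fun x y h => he (by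
    have := hp.injective h
    omega)
  have hβ : Function.Injective fun x => p (2 * (e x + m) + 1) := fun x y h => he (by
    have := hp.injective h
    omega)
  let a := ofSeq id (fun x => p (2 * (e x + m))) Function.injective_id hα
  let a' := ofSeq (fun x => p (2 * (e x + m))) id hα Function.injective_id
  let b := ofSeq id (fun x => p (2 * (e x + m) + 1)) Function.injective_id hβ
  let b' := ofSeq (fun x => p (2 * (e x + m) + 1)) id hβ Function.injective_id
  refine bsLe_of_subset_closure_union (B' := fibrewise π) (C := {a, b'}) ?_
    (bsLe_fibrewise (hT.mono le_top) hπ) (Set.toFinite _).countable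
  intro f _
  have hf : f = a * (a' * f * b) * b' := by
    refine ext_iff_some fun x y => ?_
    simp only [mul_eq_some, ofSeq_eq_some, a, a', b, b']
    constructor
    · intro h
      exact ⟨_, ⟨_, ⟨x, rfl, rfl⟩, y, ⟨x, ⟨x, rfl, rfl⟩, h⟩, y, rfl, rfl⟩, y, rfl, rfl⟩
    · rintro ⟨_, ⟨_, ⟨x, rfl, rfl⟩, _, ⟨_, ⟨x', hx, rfl⟩, h⟩, y, rfl, rfl⟩, y', hy, rfl⟩
      rwa [← hα hx, hβ hy]
  rw [SetLike.mem_coe, hf]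
  -- A copy of f on the ray `p`, from even to odd positions, all at or beyond the common initial
  -- term `m`.
  set F := a' * f * b with hFdef
  have hF : ∀ x y, F x = some y → ∃ i j, p (2 * i) = x ∧ p (2 * j + 1) = y ∧ m ≤ i ∧ m ≤ j := by
    intro x y h
    simp only [hFdef, mul_eq_some, ofSeq_eq_some, a', b] at h
    obtain ⟨_, ⟨_, ⟨x, rfl, rfl⟩, -⟩, y, rfl, rfl⟩ := h
    exact ⟨_, _, rfl, rfl, Nat.le_add_left _ _, Nat.le_add_left _ _⟩
  let ρ : ℕ → ℕ → Prop := fun i j => F (p i) = some (p j)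
  have hρ : ∀ i j, ρ i j → i % 2 = 0 ∧ j % 2 = 1 ∧ m ≤ i ∧ m ≤ j := by
    intro i j h
    obtain ⟨i', j', hi, hj, hi', hj'⟩ := hF _ _ h
    have := hp.injective hi
    have := hp.injective hj
    omega
  have hρ₁ : ∀ i j k, ρ i j → ρ i k → j = k := fun i j k hij hik =>
    hp.injective (Option.some.inj (hij.symm.trans hik))
  have hρ₂ : ∀ i j k, ρ i k → ρ j k → i = j := fun i j k hik hjk =>
    hp.injective (F.inj_of_eq_some hik hjk)
  obtain ⟨c, d, hcd⟩ := exists_interleaved_blocks M hM hmono hle ρ hρ₁ hρ₂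
    fun c i j h => by rw [hm]; exact (hρ i j h).2.2
  let same : ℕ → ℕ → Prop := fun i j => ∀ k, i < M c k ↔ j < M c k
  -- The move from i to j is made by the first factor if it stays in a block of `c`, and otherwise
  -- by the second, when it stays in a block of `d`. Parity keeps the intermediate positions k of
  -- the two kinds disjoint, so both factors are injective.
  let mid : ℕ → ℕ → ℕ → Prop := fun i j k => ρ i j ∧ ((same i j ∧ k = j) ∨ (¬ same i j ∧ k = i))
  have mid₁ : ∀ i j k i' j' k', mid i j k → mid i' j' k' → i = i' → j = j' ∧ k = k' := by
    rintro i j k i' j' k' ⟨h₁, h₂⟩ ⟨h₁', h₂'⟩ rfl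
    obtain rfl := hρ₁ _ _ _ h₁ h₁'
    refine ⟨rfl, ?_⟩
    rcases h₂ with h₂ | h₂ <;> rcases h₂' with h₂' | h₂'
    exacts [h₂.2.trans h₂'.2.symm, absurd h₂.1 h₂'.1, absurd h₂'.1 h₂.1, h₂.2.trans h₂'.2.symm]
  have mid₂ : ∀ i j k i' j' k', mid i j k → mid i' j' k' → k = k' → i = i' ∧ j = j' := by
    rintro i j k i' j' k' ⟨h₁, h₂⟩ ⟨h₁', h₂'⟩ rfl
    have hp₁ := hρ _ _ h₁
    have hp₂ := hρ _ _ h₁'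
    rcases h₂ with ⟨-, rfl⟩ | ⟨-, rfl⟩ <;> rcases h₂' with ⟨-, h⟩ | ⟨-, h⟩
    · subst h
      exact ⟨hρ₂ _ _ _ h₁ h₁', rfl⟩
    · omega
    · omega
    · subst h
      exact ⟨rfl, hρ₁ _ _ _ h₁ h₁'⟩
  have mid₃ : ∀ i j k i' j' k', mid i j k → mid i' j' k' → j = j' → i = i' := by
    rintro i j k i' j' k' ⟨h₁, -⟩ ⟨h₁', -⟩ rfl
    exact hρ₂ _ _ _ h₁ h₁'
  let G : SymInvMonoid X := ofRel (fun x z => ∃ i j k, mid i j k ∧ p i = x ∧ p k = z)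
    (by
      rintro _ _ _ ⟨i, j, k, h, rfl, rfl⟩ ⟨i', j', k', h', hi, rfl⟩
      rw [(mid₁ _ _ _ _ _ _ h h' (hp.injective hi.symm)).2])
    (by
      rintro _ _ _ ⟨i, j, k, h, rfl, rfl⟩ ⟨i', j', k', h', rfl, hk⟩
      rw [(mid₂ _ _ _ _ _ _ h h' (hp.injective hk.symm)).1])
  let H : SymInvMonoid X := ofRel (fun z y => ∃ i j k, mid i j k ∧ p k = z ∧ p j = y)
    (by
      rintro _ _ _ ⟨i, j, k, h, rfl, rfl⟩ ⟨i', j', k', h', hk, rfl⟩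
      rw [(mid₂ _ _ _ _ _ _ h h' (hp.injective hk.symm)).2])
    (by
      rintro _ _ _ ⟨i, j, k, h, rfl, rfl⟩ ⟨i', j', k', h', rfl, hj⟩
      have := mid₃ _ _ _ _ _ _ h h' (hp.injective hj.symm)
      rw [(mid₁ _ _ _ _ _ _ h h' this).2])
  have hGH : F = G * H := by
    refine ext_iff_some fun x y => ?_
    simp only [mul_eq_some, G, H, ofRel_eq_some]
    constructor
    · intro h
      obtain ⟨i, j, rfl, rfl, -⟩ := hF x y h
      obtain ⟨k, hk⟩ : ∃ k, mid (2 * i) (2 * j + 1) k := by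
        rcases Classical.em (same (2 * i) (2 * j + 1)) with hs | hs
        · exact ⟨_, h, Or.inl ⟨hs, rfl⟩⟩
        · exact ⟨_, h, Or.inr ⟨hs, rfl⟩⟩
      exact ⟨p k, ⟨_, _, k, hk, rfl, rfl⟩, _, _, k, hk, rfl, rfl⟩
    · rintro ⟨_, ⟨i, j, k, h, rfl, rfl⟩, i', j', k', h', hk, rfl⟩
      obtain ⟨rfl, rfl⟩ := mid₂ _ _ _ _ _ _ h h' (hp.injective hk.symm)
      exact h.1
  have hmem : ∀ g ∈ ({a, b'} : Set (SymInvMonoid X)), g ∈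
      Subsemigroup.closure (T.pathBijections ∪ fibrewise π ∪ {a, b'}) :=
    fun g hg => Subsemigroup.subset_closure (Or.inr hg)
  have hS : T.pathBijections ⊆ T.pathBijections ∪ fibrewise π ∪ {a, b'} := fun g hg =>
    Or.inl (Or.inl hg)
  have hπS : fibrewise π ⊆ T.pathBijections ∪ fibrewise π ∪ {a, b'} := fun g hg =>
    Or.inl (Or.inr hg)
  rw [hGH]
  refine mul_mem (mul_mem (hmem a (by simp)) (mul_mem ?_ ?_)) (hmem b' (by simp))
  · refine mem_closure_of_fibrewise hp (hφ c) hS hπS fun x z hxz => ?_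
    obtain ⟨i, j, k, ⟨-, h⟩, rfl, rfl⟩ := ofRel_eq_some.1 hxz
    refine ⟨i, k, rfl, rfl, ?_⟩
    rcases h with ⟨hs, rfl⟩ | ⟨-, rfl⟩
    · exact hblock c i k hs
    · rfl
  · refine mem_closure_of_fibrewise hp (hφ d) hS hπS fun z y hzy => ?_
    obtain ⟨i, j, k, ⟨hij, h⟩, rfl, rfl⟩ := ofRel_eq_some.1 hzy
    refine ⟨k, j, rfl, rfl, ?_⟩
    rcases h with ⟨-, rfl⟩ | ⟨hs, rfl⟩
    · rfl
    · exact hblock d k j ((hcd k j hij).resolve_left hs)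

end RootedTreeOn

/-! ### The trichotomy -/

theorem mainTheorem1 {X : Type u} [Countable X] [Infinite X] (T : RootedTreeOn X)
    (Pω : Set (Set X)) (hPω : IsUnboundedPartition Cardinal.aleph0 Pω) :
    ExactlyOneOfThree
      (T.HasBranchingSubtree ⊤ ∧ BSEquiv T.pathBijections Set.univ)
      (¬ T.HasBranchingSubtree ⊤ ∧ T.HasBranchingSubtree 3 ∧ BSEquiv T.pathBijections (PStab Pω))
      (T.rootedPaths.Countable ∧ BSEquiv T.pathBijections ∅) := by
  by_cases h : T.HasBranchingSubtree ⊤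
  · exact Or.inl ⟨⟨h, BSLe.of_subset (Set.subset_univ _), RootedTreeOn.bsLe_univ_pathBijections h⟩,
      fun h' => h'.1 h, fun h' => RootedTreeOn.not_countable_rootedPaths (h.mono le_top) h'.1⟩
  by_cases h₃ : T.HasBranchingSubtree 3
  · exact Or.inr (Or.inl ⟨fun h' => h h'.1,
      ⟨h, h₃, RootedTreeOn.bsLe_pathBijections_pStab hPω h,
        RootedTreeOn.bsLe_pStab_pathBijections hPω h₃⟩,
      fun h' => RootedTreeOn.not_countable_rootedPaths h₃ h'.1⟩)
  · have hc : T.rootedPaths.Countable := RootedTreeOn.countable_rootedPaths_iff.2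
      (RootedTreeOn.countable_rays_of_not_hasBranchingSubtree_three h₃)
    exact Or.inr (Or.inr ⟨fun h' => h h'.1, fun h' => h₃ h'.2.1, hc,
      RootedTreeOn.bsLe_pathBijections_empty hc, BSLe.of_subset (Set.empty_subset _)⟩)
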